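/- Let $n, d \ge 2$ be coprime integers, let $K$ be an algebraically closed field with $\operatorname{char}(K) \nmid n$, let $\zeta \in K$ be a primitive $n$th root of unity, and let $\alpha_1, \dots, \alpha_d \in K$ be distinct. Let $\mathcal{C}$ be the smooth projective model of the affine curve $$y^n = (x + \alpha_1) \cdots (x + \alpha_d).$$ It has exactly one point $\infty$ at infinity (that is, at which $x$ has a pole), and for each $i$ exactly one point $P_i = (-\alpha_i, 0)$. Let $\mathcal{J}$ be the group of $K$-points of the jacobian of $\mathcal{C}$, i.e. the group of divisors of degree $0$ on $\mathcal{C}$ modulo principal divisors. The automorphism $\zeta : (x, y) \mapsto (x, \zeta y)$ of $\mathcal{C}$ induces an automorphism $\zeta$ of $\mathcal{J}$; let $\mathcal{J}[1 - \zeta]$ be the kernel of $1 - \zeta$ on $\mathcal{J}$, and let $\mathcal{P} = \{P_1, \dots, P_d\}$. Then $\mathcal{J}[1-\zeta]$ is a $\mathbf{Z}/n\mathbf{Z}$-module, and there is a split exact sequence of $\mathbf{Z}/n\mathbf{Z}$-modules $$0 \longrightarrow \mathbf{Z}/n\mathbf{Z} \overset{\Delta}{\longrightarrow} (\mathbf{Z}/n\mathbf{Z})^{\mathcal{P}}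 \overset{s}{\longrightarrow} \mathcal{J}[1 - \zeta] \longrightarrow 0,$$ where $\Delta(1) = (1, \dots, 1)$ and $s(a_1, \dots, a_d) = \sum_{i=1}^d a_i [P_i - \infty]$. In particular, the classes $[P_i - \infty]$ generate $\mathcal{J}[1 - \zeta]$, they satisfy $\sum_{i=1}^d [P_i - \infty] = 0$, and the kernel of $s$ is generated by $(1, \dots, 1)$. -/

import Mathlib

open Polynomial
open scoped WithZero

/-- The data of a superelliptic curve `y ^ n = (x + α₁) ⋯ (x + α_d)` over a field `K`:
coprime integers `n, d ≥ 2` with `char K ∤ n`, and distinct `α₁, …, α_d ∈ K`. -/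
structure SuperellipticCurve (K : Type*) [Field K] where
  n : ℕ
  d : ℕ
  two_le_n : 2 ≤ n
  two_le_d : 2 ≤ d
  coprime : Nat.Coprime n d
  char_not_dvd : ¬ ringChar K ∣ n
  α : Fin d → K
  α_injective : Function.Injective α

namespace SuperellipticCurve

section Definitions

variable {K : Type*} [Field K] (E : SuperellipticCurve K)

/-! ### The function field -/

/-- The polynomial `(x + α₁) ⋯ (x + α_d)` in `K[x]`. -/
noncomputable def f : K[X] := ∏ i, (X + C (E.α i))

/-- The defining equation `Y ^ n - (x + α₁) ⋯ (x + α_d)`, a polynomial in `Y` over `K[x]`. -/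
noncomputable def equation : K[X][X] := X ^ E.n - C E.f

theorem equation_monic : E.equation.Monic :=
  monic_X_pow_sub_C _ (by have := E.two_le_n; omega)

theorem equation_natDegree : E.equation.natDegree = E.n := natDegree_X_pow_sub_C

/-- The defining equation is irreducible, by Eisenstein's criterion at `x + α₁`. -/
theorem equation_irreducible : Irreducible E.equation := by
  classical
  have hn := E.two_le_n
  have hd := E.two_le_d
  let i₀ : Fin E.d := ⟨0, by omega⟩
  have hirr : Irreducible (X + C (E.α i₀)) := irreducible_of_degree_eq_one (degree_X_add_C _)
  have hprime : Prime (X + C (E.α i₀)) := hirr.prime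
  have hdeg : E.equation.degree = E.n := degree_X_pow_sub_C (by omega) _
  have hf : E.f = (X + C (E.α i₀)) * ∏ i ∈ Finset.univ.erase i₀, (X + C (E.α i)) :=
    (Finset.mul_prod_erase _ _ (Finset.mem_univ i₀)).symm
  have h0 : E.equation.coeff 0 = - E.f := by
    simp [equation, coeff_X_pow, show (0 : ℕ) ≠ E.n by omega]
  refine irreducible_of_eisenstein_criterion (P := Ideal.span {X + C (E.α i₀)})
    ((Ideal.span_singleton_prime hprime.ne_zero).2 hprime) ?_ ?_ ?_ ?_ E.equation_monic.isPrimitive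
  · rw [E.equation_monic.leadingCoeff]
    exact fun h => hprime.not_isUnit (isUnit_of_dvd_one (Ideal.mem_span_singleton.1 h))
  · intro m hm
    rw [hdeg] at hm
    have hm' : m < E.n := by exact_mod_cast hm
    rw [Ideal.mem_span_singleton]
    rcases Nat.eq_zero_or_pos m with rfl | hpos
    · rw [h0, dvd_neg, hf]; exact dvd_mul_right _ _
    · have : E.equation.coeff m = 0 := by
        simp [equation, coeff_X_pow, coeff_C, hm'.ne, hpos.ne']
      rw [this]; exact dvd_zero _
  · rw [hdeg]; exact_mod_cast (by omega : 0 < E.n)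
  · rw [h0, Ideal.span_singleton_pow, Ideal.mem_span_singleton, dvd_neg, hf, sq]
    intro h
    have h1 := (mul_dvd_mul_iff_left hprime.ne_zero).1 h
    obtain ⟨i, hi, hdvd⟩ := (hprime.dvd_finsetProd_iff _).1 h1
    have hroot : (X + C (E.α i)).eval (-E.α i₀) = 0 := by
      obtain ⟨q, hq⟩ := hdvd
      rw [hq]; simp
    have : E.α i = E.α i₀ := by
      simp only [eval_add, eval_X, eval_C] at hroot
      linear_combination hroot
    exact (Finset.ne_of_mem_erase hi) (E.α_injective this)

/-- The coordinate ring `K[x, y] / (y ^ n - (x + α₁) ⋯ (x + α_d))` of the affine curve. -/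
abbrev CoordinateRing : Type _ := AdjoinRoot E.equation

instance : IsDomain E.CoordinateRing :=
  AdjoinRoot.isDomain_of_prime E.equation_irreducible.prime

/-- The function field `K(𝒞)`, the fraction field of the coordinate ring. -/
abbrev FunctionField : Type _ := FractionRing E.CoordinateRing

/-- The coordinate function `x`. -/
noncomputable def x : E.FunctionField :=
  algebraMap E.CoordinateRing E.FunctionField (AdjoinRoot.of E.equation X)

/-- The coordinate function `y`. -/
noncomputable def y : E.FunctionField :=
  algebraMap E.CoordinateRing E.FunctionField (AdjoinRoot.root E.equation)

/-! ### The automorphism of the function field attached to `ζ` -/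

/-- `AdjoinRoot.root` solves the equation after multiplication by an `n`th root of unity. -/
theorem eval₂_mul_root {ζ : K} (hζ : ζ ^ E.n = 1) :
    E.equation.eval₂ (algebraMap K[X] E.CoordinateRing)
      (algebraMap K E.CoordinateRing ζ * AdjoinRoot.root E.equation) = 0 := by
  have h : AdjoinRoot.root E.equation ^ E.n - algebraMap K[X] E.CoordinateRing E.f = 0 := by
    have h := AdjoinRoot.eval₂_root E.equation
    rwa [show E.equation.eval₂ (AdjoinRoot.of E.equation) (AdjoinRoot.root E.equation) =
      AdjoinRoot.root E.equation ^ E.n - algebraMap K[X] E.CoordinateRing E.f from by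
        rw [show ∀ g : E.CoordinateRing, E.equation.eval₂ (AdjoinRoot.of E.equation) g =
          (X ^ E.n - C E.f : K[X][X]).eval₂ (AdjoinRoot.of E.equation) g from fun _ => rfl,
          eval₂_sub, eval₂_pow, eval₂_X, eval₂_C]
        rfl] at h
  rw [show ∀ g : E.CoordinateRing, E.equation.eval₂ (algebraMap K[X] E.CoordinateRing) g =
      (X ^ E.n - C E.f : K[X][X]).eval₂ (algebraMap K[X] E.CoordinateRing) g from fun _ => rfl,
    eval₂_sub, eval₂_pow, eval₂_X, eval₂_C, mul_pow, ← map_pow, hζ, map_one, one_mul]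
  exact h

/-- The `K[x]`-algebra endomorphism `y ↦ ζ y` of the coordinate ring. -/
noncomputable def scaleHom {ζ : K} (hζ : ζ ^ E.n = 1) :
    E.CoordinateRing →ₐ[K[X]] E.CoordinateRing :=
  AdjoinRoot.liftAlgHom E.equation (Algebra.ofId K[X] E.CoordinateRing)
    (algebraMap K E.CoordinateRing ζ * AdjoinRoot.root E.equation) (E.eval₂_mul_root hζ)

theorem scaleHom_root {ζ : K} (hζ : ζ ^ E.n = 1) :
    E.scaleHom hζ (AdjoinRoot.root E.equation) =
      algebraMap K E.CoordinateRing ζ * AdjoinRoot.root E.equation :=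
  AdjoinRoot.lift_root (E.eval₂_mul_root hζ)

theorem scaleHom_algebraMap {ζ : K} (hζ : ζ ^ E.n = 1) (c : K) :
    E.scaleHom hζ (algebraMap K E.CoordinateRing c) = algebraMap K E.CoordinateRing c := by
  rw [IsScalarTower.algebraMap_apply K K[X] E.CoordinateRing, AlgHom.commutes]

theorem scaleHom_comp {ζ ξ : K} (hζ : ζ ^ E.n = 1) (hξ : ξ ^ E.n = 1) (h : ζ * ξ = 1) :
    (E.scaleHom hζ).comp (E.scaleHom hξ) = AlgHom.id K[X] E.CoordinateRing := by
  apply AdjoinRoot.algHom_ext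
  rw [AlgHom.comp_apply, scaleHom_root, map_mul, scaleHom_root, scaleHom_algebraMap, ← mul_assoc,
    ← map_mul, mul_comm ξ ζ, h, map_one, one_mul, AlgHom.id_apply]

/-- The `K[x]`-algebra automorphism `y ↦ ζ y` of the coordinate ring. -/
noncomputable def scaleEquiv {ζ : K} (hζ : IsPrimitiveRoot ζ E.n) :
    E.CoordinateRing ≃ₐ[K[X]] E.CoordinateRing :=
  AlgEquiv.ofAlgHom (E.scaleHom hζ.pow_eq_one) (E.scaleHom hζ.inv.pow_eq_one)
    (E.scaleHom_comp _ _ (mul_inv_cancel₀ (hζ.ne_zero (by have := E.two_le_n; omega))))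
    (E.scaleHom_comp _ _ (inv_mul_cancel₀ (hζ.ne_zero (by have := E.two_le_n; omega))))

/-- The automorphism `h ↦ h ∘ ζ` of the function field, with `x ↦ x` and `y ↦ ζ y`. -/
noncomputable def pullback {ζ : K} (hζ : IsPrimitiveRoot ζ E.n) :
    E.FunctionField ≃+* E.FunctionField :=
  IsFractionRing.ringEquivOfRingEquiv (E.scaleEquiv hζ).toRingEquiv

theorem pullback_algebraMap {ζ : K} (hζ : IsPrimitiveRoot ζ E.n) (r : E.CoordinateRing) :
    E.pullback hζ (algebraMap E.CoordinateRing E.FunctionField r) =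
      algebraMap E.CoordinateRing E.FunctionField (E.scaleHom hζ.pow_eq_one r) :=
  IsFractionRing.ringEquivOfRingEquiv_algebraMap _ _

theorem pullback_const {ζ : K} (hζ : IsPrimitiveRoot ζ E.n) (c : K) :
    E.pullback hζ (algebraMap K E.FunctionField c) = algebraMap K E.FunctionField c := by
  rw [IsScalarTower.algebraMap_apply K E.CoordinateRing E.FunctionField, pullback_algebraMap,
    scaleHom_algebraMap]

theorem pullback_x {ζ : K} (hζ : IsPrimitiveRoot ζ E.n) : E.pullback hζ E.x = E.x := by
  rw [x, pullback_algebraMap]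
  exact congrArg _ ((E.scaleHom hζ.pow_eq_one).commutes X)

theorem pullback_y {ζ : K} (hζ : IsPrimitiveRoot ζ E.n) :
    E.pullback hζ E.y = algebraMap K E.FunctionField ζ * E.y := by
  rw [y, pullback_algebraMap, scaleHom_root, map_mul,
    ← IsScalarTower.algebraMap_apply K E.CoordinateRing E.FunctionField]

/-! ### The points of the smooth projective model -/

/-- A closed point of the smooth projective model `𝒞`, for `K` algebraically closed: a normalized
discrete valuation of the function field `K(𝒞)` that is trivial on `K`. The valuation is written
multiplicatively, so that a function `h ≠ 0` with order of vanishing `m` has the value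
`exp (-m)`. -/
@[ext]
structure Point where
  val : Valuation E.FunctionField ℤᵐ⁰
  surjective : Function.Surjective val
  map_const : ∀ c : K, c ≠ 0 → val (algebraMap K E.FunctionField c) = 1

variable {E}

/-- The order of vanishing `v_P(h)` of a (nonzero) rational function `h` at the point `P`. -/
noncomputable def Point.ord (P : E.Point) (h : E.FunctionField) : ℤ := -WithZero.log (P.val h)

theorem Point.ord_mul (P : E.Point) {g h : E.FunctionField} (hg : g ≠ 0) (hh : h ≠ 0) :
    P.ord (g * h) = P.ord g + P.ord h := by
  have hg' : P.val g ≠ 0 := (Valuation.ne_zero_iff _).2 hg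
  have hh' : P.val h ≠ 0 := (Valuation.ne_zero_iff _).2 hh
  rw [ord, ord, ord, map_mul, WithZero.log_mul hg' hh']
  ring

theorem Point.ord_one (P : E.Point) : P.ord 1 = 0 := by simp [ord]

theorem Point.ord_inv (P : E.Point) (h : E.FunctionField) : P.ord h⁻¹ = -P.ord h := by
  simp [ord]

/-- `P` is the point with affine coordinates `(a, b)`: the functions `x - a` and `y - b` vanish
at `P`. -/
def Point.HasCoordinates (P : E.Point) (a b : K) : Prop :=
  P.val (E.x - algebraMap K E.FunctionField a) < 1 ∧
    P.val (E.y - algebraMap K E.FunctionField b) < 1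

/-- `P` lies at infinity: the function `x` has a pole at `P`. -/
def Point.IsAtInfinity (P : E.Point) : Prop := 1 < P.val E.x

/-- The action of `ζ` on points: `v_{ζ P}(h) = v_P(h ∘ ζ)`. -/
noncomputable def Point.rotate {ζ : K} (hζ : IsPrimitiveRoot ζ E.n) (P : E.Point) : E.Point where
  val := P.val.comap (E.pullback hζ : E.FunctionField →+* E.FunctionField)
  surjective := P.surjective.comp (E.pullback hζ).surjective
  map_const c hc := by
    change P.val (E.pullback hζ (algebraMap K E.FunctionField c)) = 1
    rw [pullback_const, P.map_const c hc]

theorem Point.ord_rotate {ζ : K} (hζ : IsPrimitiveRoot ζ E.n) (P : E.Point)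
    (h : E.FunctionField) : (P.rotate hζ).ord h = P.ord (E.pullback hζ h) := rfl

/-- On affine coordinates, `ζ` acts as `(a, b) ↦ (a, ζ b)`. -/
theorem Point.HasCoordinates.rotate {ζ : K} (hζ : IsPrimitiveRoot ζ E.n) {P : E.Point} {a b : K}
    (h : P.HasCoordinates a b) : (P.rotate hζ).HasCoordinates a (ζ * b) := by
  refine ⟨?_, ?_⟩
  · change P.val (E.pullback hζ _) < 1
    rw [map_sub, pullback_x, pullback_const]
    exact h.1
  · change P.val (E.pullback hζ _) < 1
    rw [map_sub, pullback_y, pullback_const, map_mul, ← mul_sub, map_mul,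
      P.map_const ζ (hζ.ne_zero (by have := E.two_le_n; omega)), one_mul]
    exact h.2

theorem Point.rotate_injective {ζ : K} (hζ : IsPrimitiveRoot ζ E.n) :
    Function.Injective (Point.rotate hζ : E.Point → E.Point) := by
  intro P Q h
  ext g
  obtain ⟨g', rfl⟩ := (E.pullback hζ).surjective g
  exact DFunLike.congr_fun (congrArg Point.val h) g'

theorem Point.rotate_surjective {ζ : K} (hζ : IsPrimitiveRoot ζ E.n) :
    Function.Surjective (Point.rotate hζ : E.Point → E.Point) := by
  intro P
  refine ⟨⟨P.val.comap ((E.pullback hζ).symm : E.FunctionField →+* E.FunctionField),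
    P.surjective.comp (E.pullback hζ).symm.surjective, fun c hc => ?_⟩, ?_⟩
  · change P.val ((E.pullback hζ).symm (algebraMap K E.FunctionField c)) = 1
    rw [show (E.pullback hζ).symm (algebraMap K E.FunctionField c) = algebraMap K E.FunctionField c
      from (RingEquiv.symm_apply_eq _).2 (E.pullback_const hζ c).symm, P.map_const c hc]
  · ext g
    change P.val ((E.pullback hζ).symm (E.pullback hζ g)) = P.val g
    rw [RingEquiv.symm_apply_apply]

/-! ### Divisors and the jacobian -/

variable (E)

/-- The group of divisors on `𝒞`: finite formal sums of points. -/
abbrev Div : Type _ := E.Point →₀ ℤ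

/-- The degree of a divisor (the residue fields are all `K`, for `K` algebraically closed). -/
noncomputable def degree : E.Div →+ ℤ := Finsupp.liftAddHom fun _ => AddMonoidHom.id ℤ

theorem degree_single (P : E.Point) (m : ℤ) : E.degree (Finsupp.single P m) = m := by
  simp [degree]

/-- The group of divisors of degree zero. -/
noncomputable def DivZero : AddSubgroup E.Div := E.degree.ker

/-- The group of principal divisors `∑_P v_P(h) P`, for nonzero rational functions `h`. -/
def Princ : AddSubgroup E.Div where
  carrier := {D | ∃ h : E.FunctionField, h ≠ 0 ∧ ∀ P : E.Point, D P = P.ord h}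
  zero_mem' := ⟨1, one_ne_zero, fun P => by simp [P.ord_one]⟩
  add_mem' := by
    rintro D D' ⟨g, hg, hD⟩ ⟨h, hh, hD'⟩
    exact ⟨g * h, mul_ne_zero hg hh, fun P => by
      rw [Finsupp.add_apply, hD, hD', P.ord_mul hg hh]⟩
  neg_mem' := by
    rintro D ⟨g, hg, hD⟩
    exact ⟨g⁻¹, inv_ne_zero hg, fun P => by rw [Finsupp.neg_apply, hD, P.ord_inv]⟩

/-- The group of `K`-points of the jacobian of `𝒞`: divisors of degree zero modulo principal
divisors. -/
abbrev Jacobian : Type _ := E.DivZero ⧸ E.Princ.addSubgroupOf E.DivZero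

/-- The divisor `P - Q`, of degree zero. -/
noncomputable def subDiv (P Q : E.Point) : E.DivZero :=
  ⟨Finsupp.single P 1 - Finsupp.single Q 1, by
    change E.degree _ = 0
    rw [map_sub, degree_single, degree_single, sub_self]⟩

/-- The class `[P - Q]` in the jacobian. -/
noncomputable def divClass (P Q : E.Point) : E.Jacobian := QuotientAddGroup.mk (E.subDiv P Q)

variable {E}
variable {ζ : K} (hζ : IsPrimitiveRoot ζ E.n)

/-- The action of `ζ` on divisors: `∑ m_P P ↦ ∑ m_P (ζ P)`. -/
noncomputable def rotateDiv : E.Div →+ E.Div := Finsupp.mapDomain.addMonoidHom (Point.rotate hζ)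

theorem rotateDiv_single (P : E.Point) (m : ℤ) :
    rotateDiv hζ (Finsupp.single P m) = Finsupp.single (P.rotate hζ) m :=
  Finsupp.mapDomain_single

theorem degree_rotateDiv (D : E.Div) : E.degree (rotateDiv hζ D) = E.degree D := by
  have : E.degree.comp (rotateDiv hζ) = E.degree := by
    ext P
    simp [rotateDiv_single, degree_single]
  exact DFunLike.congr_fun this D

theorem rotateDiv_mem_princ {D : E.Div} (hD : D ∈ E.Princ) : rotateDiv hζ D ∈ E.Princ := by
  obtain ⟨g, hg, hDg⟩ := hD
  refine ⟨(E.pullback hζ).symm g, by simpa using hg, fun P => ?_⟩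
  obtain ⟨Q, rfl⟩ := Point.rotate_surjective hζ P
  rw [Point.ord_rotate, RingEquiv.apply_symm_apply, ← hDg]
  exact Finsupp.mapDomain_apply (Point.rotate_injective hζ) D Q

/-- The action of `ζ` on divisors of degree zero. -/
noncomputable def rotateDivZero : E.DivZero →+ E.DivZero :=
  ((rotateDiv hζ).comp E.DivZero.subtype).codRestrict E.DivZero fun D =>
    (degree_rotateDiv hζ D).trans D.2

/-- The endomorphism `ζ` of the jacobian, `[∑ m_P P] ↦ [∑ m_P (ζ P)]`. -/
noncomputable def rotateJacobian : E.Jacobian →+ E.Jacobian :=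
  QuotientAddGroup.map _ _ (rotateDivZero hζ) fun _ hD => rotateDiv_mem_princ hζ hD

/-- The group `𝒥[1 - ζ]`, the kernel of the endomorphism `1 - ζ` of the jacobian. -/
noncomputable def oneSubZetaTorsion : AddSubgroup E.Jacobian :=
  (AddMonoidHom.id E.Jacobian - rotateJacobian hζ).ker

end Definitions

end SuperellipticCurve

/-! The theorem follows from local computations on the curve and from Hilbert's Theorem 90 for the
cyclic extension `K(𝒞) / K(x)`.

Locally: `y` is a local parameter at each `P_i`, where `x + α_i` has order `n`; at any other finite
point `x - a` is a local parameter, and the fibre of `x` is a free orbit of `ζ` with `n` elements;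
at infinity `x` and `y` have orders `-n` and `-d`, because `n` and `d` are coprime. Hence `n (P_i -
∞)` is the divisor of `x + α_i`, and `∑ (P_i - ∞)` is the divisor of `y`.

Globally, decomposing functions into eigenvectors of `ζ` and taking norms to `K(x)` reduces two
facts to polynomials: functions without poles are constant (`exists_eq_const_of_val_le_one`) and
principal divisors have degree zero (`degree_divisor`).

Surjectivity of `s`: if `D - ζ D` is the divisor of `h`, the norm of `h` has no zeros or poles,
because the orders telescope along orbits. After rescaling by a constant the norm is `1`, and
Hilbert 90 makes `D` equivalent to an invariant divisor (`exists_invariant_sub_divisor`). In an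
invariant divisor the free orbits are removed by functions `x - a`, which leaves a combination of
the `P_i` and `∞` of degree zero.

Kernel of `s`: if `∑ a_i (P_i - ∞)` is the divisor of `h`, then `h ∘ ζ = c h` with `c = ζ ^ j`, so
`h / y ^ j` lies in `K(x)`. Its order `a_i - j` at `P_i` is then divisible by `n`
(`exists_forall_dvd_sub_of_mem_princ`).

The sequence splits because any coordinate projection is a retraction of `Δ`. -/

open scoped IntermediateField.algebraAdjoinAdjoin in
/-- A discrete valuation trivial on `K` at which a given transcendental element vanishes. -/
theorem exists_valuation_lt_one_of_transcendental {K F : Type*} [Field K] [Field F] [Algebra K F]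
    {t : F} (ht : Transcendental K t) [FiniteDimensional (IntermediateField.adjoin K {t}) F]
    [Algebra.IsSeparable (IntermediateField.adjoin K {t}) F] :
    ∃ v : Valuation F ℤᵐ⁰, Function.Surjective v ∧
      (∀ c : K, c ≠ 0 → v (algebraMap K F c) = 1) ∧ v t < 1 := by
  let R := Algebra.adjoin K {t}
  let k := IntermediateField.adjoin K {t}
  have hpir : IsPrincipalIdealRing R := by
    have h1 : Function.Surjective (aeval (⟨t, Algebra.self_mem_adjoin_singleton K t⟩ : R) :
        K[X] →ₐ[K] R) := by
      rintro ⟨r, hr⟩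
      obtain ⟨p, rfl⟩ := (Algebra.adjoin_singleton_eq_range_aeval K t ▸ hr :
        r ∈ (aeval t : K[X] →ₐ[K] F).range)
      refine ⟨p, Subtype.ext ?_⟩
      exact (Subalgebra.aeval_coe R ⟨t, _⟩ p).symm
    exact IsPrincipalIdealRing.of_surjective _ h1
  have : IsDedekindDomain R := inferInstance
  have : IsFractionRing R k := inferInstanceAs (IsFractionRing (Algebra.adjoin K {t})
    (IntermediateField.adjoin K {t}))
  have : IsScalarTower R k F := IsScalarTower.of_algebraMap_eq fun _ => rfl
  -- Finiteness and separability of `F` over `K(t)` make `B` a Dedekind domain with fraction field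
  -- `F`. The valuation sought is the one of a prime of `B` containing `t`.
  let B := integralClosure R F
  have : IsDedekindDomain B := integralClosure.isDedekindDomain R k F
  have : IsFractionRing B F := IsIntegralClosure.isFractionRing_of_finite_extension R k F B
  let T : R := ⟨t, Algebra.self_mem_adjoin_singleton K t⟩
  have hT : ¬ IsUnit T := by
    rintro h
    obtain ⟨⟨q, hq⟩, hTq⟩ := h.exists_right_inv
    obtain ⟨p, rfl⟩ := (Algebra.adjoin_singleton_eq_range_aeval K t ▸ hq :
        q ∈ (aeval t : K[X] →ₐ[K] F).range)
    have h1 : aeval t (X * p - 1 : K[X]) = 0 := by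
      have := congrArg Subtype.val hTq
      simpa [sub_eq_zero] using this
    have h2 := (transcendental_iff.1 ht) _ h1
    simpa using congrArg (eval 0) h2
  obtain ⟨M, hM, hTM⟩ := exists_max_ideal_of_mem_nonunits hT
  obtain ⟨Q, hQ, hQM⟩ := Ideal.exists_ideal_over_maximal_of_isIntegral (S := B) M (by
    intro z hz
    have hz0 : z = 0 := Subtype.ext (congrArg (fun b : B => (b : F)) (RingHom.mem_ker.1 hz))
    exact hz0 ▸ M.zero_mem)
  have hTQ : algebraMap R B T ∈ Q := by rw [← Ideal.mem_comap, hQM]; exact hTM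
  have ht0 : t ≠ 0 := fun h => ht (h ▸ isAlgebraic_zero)
  let v : IsDedekindDomain.HeightOneSpectrum B := ⟨Q, hQ.isPrime, by
    rintro rfl
    exact ht0 (congrArg Subtype.val ((Submodule.mem_bot _).1 hTQ))⟩
  refine ⟨v.valuation F, v.valuation_surjective F, fun c hc => ?_, ?_⟩
  -- Constants lie in `B`, so `c` and `c⁻¹` both have value at most `1`, while the product of their
  -- values is `1`.
  · have hle : ∀ c : K, v.valuation F (algebraMap K F c) ≤ 1 := fun c =>
      v.valuation_le_one (K := F) (algebraMap R B (algebraMap K R c))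
    refine le_antisymm (hle c) ?_
    have h1 : v.valuation F (algebraMap K F c) * v.valuation F (algebraMap K F c⁻¹) = 1 := by
      rw [← map_mul, ← map_mul, mul_inv_cancel₀ hc, map_one, map_one]
    rw [← h1]
    exact mul_le_of_le_one_right' (hle _)
  · exact (v.valuation_lt_one_iff_mem (K := F) (algebraMap R B T)).2 hTQ

/-! ### The function field as a finite separable extension of `K(x)`, and existence of points -/

namespace SuperellipticCurve

variable {K : Type*} [Field K] (E : SuperellipticCurve K)

theorem n_pos : 0 < E.n := by have := E.two_le_n; omega

theorem natCast_n_ne_zero : (E.n : K) ≠ 0 := fun h =>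
  E.char_not_dvd ((ringChar.spec K E.n).1 h)

theorem f_monic : E.f.Monic := monic_prod_of_monic _ _ fun _ _ => monic_X_add_C _

theorem natDegree_f : E.f.natDegree = E.d := by
  rw [f, natDegree_prod_of_monic _ _ fun _ _ => monic_X_add_C _]
  simp

/-- The function on the curve given by a polynomial in `x`. -/
theorem algebraMap_polynomial (p : K[X]) :
    algebraMap E.CoordinateRing E.FunctionField (AdjoinRoot.of E.equation p) = aeval E.x p := by
  have : ((algebraMap E.CoordinateRing E.FunctionField).comp (AdjoinRoot.of E.equation)) =
      (aeval E.x : K[X] →ₐ[K] E.FunctionField).toRingHom := by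
    apply Polynomial.ringHom_ext
    · intro c
      simp only [RingHom.comp_apply, AlgHom.toRingHom_eq_coe, RingHom.coe_coe, aeval_C]
      rw [IsScalarTower.algebraMap_apply K E.CoordinateRing E.FunctionField]
      rfl
    · simp [x]
  exact DFunLike.congr_fun this p

theorem of_injective : Function.Injective (AdjoinRoot.of E.equation) :=
  AdjoinRoot.of.injective_of_degree_ne_zero (by
    rw [degree_eq_natDegree E.equation_monic.ne_zero, E.equation_natDegree]
    exact_mod_cast E.n_pos.ne')

theorem aeval_x_injective : Function.Injective (aeval E.x : K[X] → E.FunctionField) := by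
  intro p q h
  rw [← algebraMap_polynomial, ← algebraMap_polynomial] at h
  exact E.of_injective (IsFractionRing.injective E.CoordinateRing E.FunctionField h)

theorem aeval_x_ne_zero {p : K[X]} (hp : p ≠ 0) : aeval E.x p ≠ 0 := fun h =>
  hp (E.aeval_x_injective (by rw [h, map_zero]))

theorem x_sub_ne_zero (a : K) : E.x - algebraMap K E.FunctionField a ≠ 0 := by
  have := E.aeval_x_ne_zero (X_sub_C_ne_zero a)
  simpa using this

theorem transcendental_x : Transcendental K E.x :=
  transcendental_iff_injective.2 E.aeval_x_injective

theorem y_pow : E.y ^ E.n = aeval E.x E.f := by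
  have h : AdjoinRoot.mk E.equation E.equation = 0 := AdjoinRoot.mk_self
  rw [show AdjoinRoot.mk E.equation E.equation = AdjoinRoot.mk E.equation (X ^ E.n - C E.f)
    from rfl, map_sub, map_pow, AdjoinRoot.mk_X, AdjoinRoot.mk_C, sub_eq_zero] at h
  rw [y, ← map_pow, h, algebraMap_polynomial]

theorem y_ne_zero : E.y ≠ 0 := by
  intro h
  have := E.y_pow
  rw [h, zero_pow E.n_pos.ne'] at this
  exact E.aeval_x_ne_zero E.f_monic.ne_zero this.symm

/-- Elements of the coordinate ring are polynomials in `y` of degree `< n`, over `K[x]`. -/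
theorem exists_eq_sum (u : E.CoordinateRing) : ∃ p : ℕ → K[X],
    algebraMap E.CoordinateRing E.FunctionField u =
      ∑ j ∈ Finset.range E.n, E.y ^ j * aeval E.x (p j) := by
  obtain ⟨g, rfl⟩ := AdjoinRoot.mk_surjective u
  have h1 : AdjoinRoot.mk E.equation g = AdjoinRoot.mk E.equation (g %ₘ E.equation) := by
    rw [AdjoinRoot.mk_eq_mk]
    exact ⟨g /ₘ E.equation, by
      rw [sub_eq_iff_eq_add']
      exact (modByMonic_add_div g E.equation).symm⟩
  refine ⟨(g %ₘ E.equation).coeff, ?_⟩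
  rw [h1]
  have h2 : (g %ₘ E.equation).natDegree < E.n := by
    rw [← E.equation_natDegree]
    refine natDegree_modByMonic_lt g E.equation_monic fun h => ?_
    have := E.equation_natDegree
    rw [h, natDegree_one] at this
    exact E.n_pos.ne this
  conv_lhs => rw [(g %ₘ E.equation).as_sum_range' E.n h2]
  simp only [map_sum]
  refine Finset.sum_congr rfl fun j _ => ?_
  rw [← C_mul_X_pow_eq_monomial, map_mul, map_pow, AdjoinRoot.mk_X, AdjoinRoot.mk_C, map_mul,
    algebraMap_polynomial, map_pow, mul_comm]
  rfl

instance : Algebra.IsAlgebraic K[X] E.CoordinateRing := by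
  have : Module.Finite K[X] E.CoordinateRing := E.equation_monic.finite_adjoinRoot
  infer_instance

/-- Nonzero elements of the coordinate ring divide nonzero polynomials in `x`. -/
theorem exists_mul_eq_aeval {u : E.CoordinateRing} (hu : u ≠ 0) :
    ∃ (w : E.CoordinateRing) (p : K[X]), p ≠ 0 ∧
      algebraMap E.CoordinateRing E.FunctionField u *
        algebraMap E.CoordinateRing E.FunctionField w = aeval E.x p := by
  obtain ⟨p, hp, w, hw⟩ := (Algebra.IsAlgebraic.isAlgebraic (R := K[X]) u).exists_nonzero_dvd
    (mem_nonZeroDivisors_of_ne_zero hu)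
  exact ⟨w, p, hp, by rw [← algebraMap_polynomial, ← map_mul, ← hw]; rfl⟩

/-- Any denominator divides a nonzero polynomial in `x`, so the fraction can be expanded by the
cofactor. -/
theorem exists_eq_div (h : E.FunctionField) : ∃ (u : E.CoordinateRing) (p : K[X]), p ≠ 0 ∧
    h = algebraMap E.CoordinateRing E.FunctionField u / aeval E.x p := by
  obtain ⟨u, w, hw, rfl⟩ := IsFractionRing.div_surjective (A := E.CoordinateRing) h
  have hw0 : w ≠ 0 := nonZeroDivisors.ne_zero hw
  obtain ⟨z, p, hp, e⟩ := E.exists_mul_eq_aeval hw0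
  refine ⟨u * z, p, hp, ?_⟩
  have hw1 : algebraMap E.CoordinateRing E.FunctionField w ≠ 0 := by simpa using hw0
  have hp1 := E.aeval_x_ne_zero hp
  rw [div_eq_div_iff hw1 hp1, ← e, map_mul]
  ring

theorem adjoin_y : IntermediateField.adjoin (IntermediateField.adjoin K {E.x}) {E.y} = ⊤ := by
  rw [eq_top_iff]
  intro h _
  obtain ⟨u, p, hp, rfl⟩ := E.exists_eq_div h
  obtain ⟨q, hq⟩ := E.exists_eq_sum u
  have hx : ∀ p : K[X], aeval E.x p ∈
      IntermediateField.adjoin (IntermediateField.adjoin K {E.x}) {E.y} := by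
    intro p
    exact (IntermediateField.adjoin (IntermediateField.adjoin K {E.x}) {E.y}).algebraMap_mem
      ⟨aeval E.x p, IntermediateField.algebra_adjoin_le_adjoin K _
        (aeval_mem_adjoin_singleton _ _)⟩
  rw [hq]
  refine div_mem (sum_mem fun j _ => mul_mem (pow_mem ?_ _) (hx _)) (hx _)
  exact IntermediateField.mem_adjoin_simple_self _ _

/-- The minimal polynomial of `y` divides `T ^ n - f(x)`, which is separable because `n` is
invertible in `K` and `f(x) ≠ 0`. -/
theorem isSeparable_y : IsSeparable (IntermediateField.adjoin K {E.x}) E.y := by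
  let k := IntermediateField.adjoin K {E.x}
  let F : k := ⟨aeval E.x E.f,
    IntermediateField.algebra_adjoin_le_adjoin K _ (aeval_mem_adjoin_singleton _ _)⟩
  have hF : F ≠ 0 := fun h => E.aeval_x_ne_zero E.f_monic.ne_zero (congrArg Subtype.val h)
  have hn : (E.n : k) ≠ 0 := by
    rw [← map_natCast (algebraMap K k)]
    exact (_root_.map_ne_zero _).2 E.natCast_n_ne_zero
  have hsep : (X ^ E.n - C F : k[X]).Separable := separable_X_pow_sub_C F hn hF
  refine hsep.of_dvd (minpoly.dvd _ _ ?_)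
  simp only [map_sub, map_pow, aeval_X, aeval_C]
  rw [sub_eq_zero, y_pow]
  rfl

instance : FiniteDimensional (IntermediateField.adjoin K {E.x}) E.FunctionField := by
  have : FiniteDimensional (IntermediateField.adjoin K {E.x})
      (IntermediateField.adjoin (IntermediateField.adjoin K {E.x}) {E.y}) :=
    IntermediateField.adjoin.finiteDimensional E.isSeparable_y.isIntegral
  rw [E.adjoin_y] at this
  exact Module.Finite.equiv IntermediateField.topEquiv.toLinearEquiv

instance : Algebra.IsSeparable (IntermediateField.adjoin K {E.x}) E.FunctionField := by
  have := IntermediateField.isSeparable_adjoin_simple_iff_isSeparable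
    (F := IntermediateField.adjoin K {E.x}) (E := E.FunctionField) |>.2 E.isSeparable_y
  rw [E.adjoin_y] at this
  exact AlgEquiv.Algebra.isSeparable IntermediateField.topEquiv

variable {E}

/-- Used with `t = x⁻¹` for the point at infinity and with `t = x - a` for the points above `a`. -/
theorem exists_point_of_adjoin_eq {t : E.FunctionField} (ht : Transcendental K t)
    (h : IntermediateField.adjoin K {t} = IntermediateField.adjoin K {E.x}) :
    ∃ P : E.Point, P.val t < 1 := by
  have : FiniteDimensional (IntermediateField.adjoin K {t}) E.FunctionField := by
    rw [h]; infer_instance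
  have : Algebra.IsSeparable (IntermediateField.adjoin K {t}) E.FunctionField := by
    rw [h]; infer_instance
  obtain ⟨v, hv, hc, hlt⟩ := exists_valuation_lt_one_of_transcendental ht
  exact ⟨⟨v, hv, hc⟩, hlt⟩

variable (E)

theorem exists_isAtInfinity : ∃ P : E.Point, P.IsAtInfinity := by
  obtain ⟨P, hP⟩ := exists_point_of_adjoin_eq (E := E) (t := E.x⁻¹)
    (fun h => E.transcendental_x (by simpa using h.inv)) (by
      refine le_antisymm ?_ ?_
      · rw [IntermediateField.adjoin_simple_le_iff]
        exact inv_mem (IntermediateField.mem_adjoin_simple_self _ _)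
      · rw [IntermediateField.adjoin_simple_le_iff]
        simpa using inv_mem (IntermediateField.mem_adjoin_simple_self K E.x⁻¹))
  refine ⟨P, ?_⟩
  rw [map_inv₀] at hP
  have h0 : P.val E.x ≠ 0 := (Valuation.ne_zero_iff _).2 fun h =>
    E.transcendental_x (h ▸ isAlgebraic_zero)
  exact (inv_lt_one₀ (zero_lt_iff.2 h0)).1 hP

theorem exists_val_x_sub_lt_one (a : K) :
    ∃ P : E.Point, P.val (E.x - algebraMap K E.FunctionField a) < 1 := by
  apply exists_point_of_adjoin_eq
  · intro h
    apply E.transcendental_x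
    simpa using h.add (isAlgebraic_algebraMap (A := E.FunctionField) a)
  · refine le_antisymm ?_ ?_
    · rw [IntermediateField.adjoin_simple_le_iff]
      exact sub_mem (IntermediateField.mem_adjoin_simple_self _ _)
        (IntermediateField.algebraMap_mem _ _)
    · rw [IntermediateField.adjoin_simple_le_iff]
      have := add_mem (IntermediateField.mem_adjoin_simple_self K
        (E.x - algebraMap K E.FunctionField a))
        ((IntermediateField.adjoin K {E.x - algebraMap K E.FunctionField a}).algebraMap_mem a)
      simpa using this

end SuperellipticCurve

namespace SuperellipticCurve

variable {K : Type*} [Field K] {E : SuperellipticCurve K}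

/-! ### Orders of vanishing -/

namespace Point

variable (P : E.Point)

theorem val_ne_zero {h : E.FunctionField} (hh : h ≠ 0) : P.val h ≠ 0 :=
  (Valuation.ne_zero_iff _).2 hh

theorem val_eq_exp {h : E.FunctionField} (hh : h ≠ 0) : P.val h = WithZero.exp (-P.ord h) := by
  rw [ord, neg_neg, WithZero.exp_log (P.val_ne_zero hh)]

theorem val_lt_one_iff {h : E.FunctionField} (hh : h ≠ 0) : P.val h < 1 ↔ 0 < P.ord h := by
  rw [P.val_eq_exp hh, ← WithZero.exp_zero, WithZero.exp_lt_exp]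
  omega

theorem val_le_one_iff {h : E.FunctionField} (hh : h ≠ 0) : P.val h ≤ 1 ↔ 0 ≤ P.ord h := by
  rw [P.val_eq_exp hh, ← WithZero.exp_zero, WithZero.exp_le_exp]
  omega

theorem val_eq_one_iff {h : E.FunctionField} (hh : h ≠ 0) : P.val h = 1 ↔ P.ord h = 0 := by
  rw [P.val_eq_exp hh, WithZero.exp_eq_one]
  omega

theorem ord_zero : P.ord 0 = 0 := by simp [ord]

theorem ord_pow (h : E.FunctionField) (k : ℕ) : P.ord (h ^ k) = k * P.ord h := by
  rw [ord, ord, map_pow, WithZero.log_pow]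
  simp

theorem ord_zpow (h : E.FunctionField) (k : ℤ) : P.ord (h ^ k) = k * P.ord h := by
  rw [ord, ord, map_zpow₀, WithZero.log_zpow]
  simp

theorem ord_div {g h : E.FunctionField} (hg : g ≠ 0) (hh : h ≠ 0) :
    P.ord (g / h) = P.ord g - P.ord h := by
  rw [div_eq_mul_inv, P.ord_mul hg (inv_ne_zero hh), P.ord_inv, sub_eq_add_neg]

theorem ord_prod {ι : Type*} (s : Finset ι) (g : ι → E.FunctionField) (hg : ∀ i ∈ s, g i ≠ 0) :
    P.ord (∏ i ∈ s, g i) = ∑ i ∈ s, P.ord (g i) := by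
  classical
  induction s using Finset.induction_on with
  | empty => simp [P.ord_one]
  | insert i s hi ih =>
    rw [Finset.prod_insert hi, Finset.sum_insert hi, P.ord_mul (hg i (by simp))
      (Finset.prod_ne_zero_iff.2 fun j hj => hg j (by simp [hj])),
      ih fun j hj => hg j (by simp [hj])]

theorem exists_ord_eq (m : ℤ) : ∃ h : E.FunctionField, h ≠ 0 ∧ P.ord h = m := by
  obtain ⟨h, hh⟩ := P.surjective (WithZero.exp (-m))
  refine ⟨h, ?_, by rw [ord, hh, WithZero.log_exp, neg_neg]⟩
  rintro rfl
  rw [map_zero] at hh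
  exact WithZero.exp_ne_zero hh.symm

theorem val_const_le (c : K) : P.val (algebraMap K E.FunctionField c) ≤ 1 := by
  rcases eq_or_ne c 0 with rfl | hc
  · simp
  · exact (P.map_const c hc).le

theorem ord_const (c : K) : P.ord (algebraMap K E.FunctionField c) = 0 := by
  rcases eq_or_ne c 0 with rfl | hc
  · rw [map_zero, P.ord_zero]
  · rw [ord, P.map_const c hc, WithZero.log_one, neg_zero]

theorem const_eq_zero_of_val_lt_one {c : K} (h : P.val (algebraMap K E.FunctionField c) < 1) :
    c = 0 := by
  by_contra hc
  exact h.ne (P.map_const c hc)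

variable {P} in
theorem eq_of_ord {Q : E.Point} (h : ∀ u : E.CoordinateRing, u ≠ 0 →
    P.ord (algebraMap _ E.FunctionField u) = Q.ord (algebraMap _ E.FunctionField u)) : P = Q := by
  ext g
  obtain ⟨u, w, hw, rfl⟩ := IsFractionRing.div_surjective (A := E.CoordinateRing) g
  have hw0 : w ≠ 0 := nonZeroDivisors.ne_zero hw
  rw [map_div₀, map_div₀]
  have key : ∀ u : E.CoordinateRing, P.val (algebraMap _ E.FunctionField u) =
      Q.val (algebraMap _ E.FunctionField u) := by
    intro u
    rcases eq_or_ne u 0 with rfl | hu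
    · simp
    · have hu' : algebraMap _ E.FunctionField u ≠ 0 := by simpa using hu
      rw [P.val_eq_exp hu', Q.val_eq_exp hu', h u hu]
  rw [key, key]

variable [IsAlgClosed K]

/-- The polynomial splits into linear factors, each of value `g`. At infinity this applies to `x`
with `g` the value of `x`; with `g = 1` it excludes finite points without coordinates. -/
theorem val_aeval_of_forall {z : E.FunctionField} {g : ℤᵐ⁰}
    (h : ∀ β : K, P.val (z - algebraMap K E.FunctionField β) = g) {p : K[X]} (hp : p ≠ 0) :
    P.val (aeval z p) = g ^ p.natDegree := by
  have hs := IsAlgClosed.splits p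
  have hcard : p.roots.card = p.natDegree := hs.natDegree_eq_card_roots.symm
  conv_lhs => rw [hs.eq_prod_roots]
  rw [map_mul, aeval_C, map_mul, P.map_const _ (leadingCoeff_ne_zero.2 hp), one_mul,
    map_multiset_prod, map_multiset_prod, Multiset.map_map, Multiset.map_map]
  rw [Multiset.map_congr rfl (g := fun _ => g) fun β _ => by simpa using h β]
  simp [hcard]

theorem exists_val_sub_lt_one {z : E.FunctionField} {p : K[X]} (hp : p ≠ 0)
    (hz : P.val z ≤ 1) (h : P.val (aeval z p) < 1) :
    ∃ β : K, p.eval β = 0 ∧ P.val (z - algebraMap K E.FunctionField β) < 1 := by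
  have hs := IsAlgClosed.splits p
  by_contra! hcon
  refine h.ne ?_
  conv_lhs => rw [hs.eq_prod_roots]
  rw [map_mul, aeval_C, map_mul, P.map_const _ (leadingCoeff_ne_zero.2 hp), one_mul,
    map_multiset_prod, map_multiset_prod, Multiset.map_map, Multiset.map_map]
  refine Multiset.prod_eq_one fun c hc => ?_
  obtain ⟨β, hβ, rfl⟩ := Multiset.mem_map.1 hc
  have h1 := hcon β (isRoot_of_mem_roots hβ)
  have h2 : P.val (z - algebraMap K E.FunctionField β) ≤ 1 :=
    P.val.map_sub_le hz (P.val_const_le β)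
  simpa using le_antisymm h2 h1

-- Congruence modulo the maximal ideal: `p(z) - p(a)` is `z - a` times a polynomial in `z`, which is
-- integral at `P`.
omit [IsAlgClosed K] in
theorem val_aeval_sub_lt_one {z : E.FunctionField} {a : K} (hz : P.val z ≤ 1)
    (h : P.val (z - algebraMap K E.FunctionField a) < 1) (p : K[X]) :
    P.val (aeval z p - algebraMap K E.FunctionField (p.eval a)) < 1 := by
  obtain ⟨q, hq⟩ := X_sub_C_dvd_sub_C_eval (p := p) (a := a)
  have h1 := congrArg (aeval z) hq
  simp only [map_sub, aeval_C, map_mul, aeval_X] at h1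
  rw [h1, map_mul]
  refine mul_lt_one_of_lt_of_le h ?_
  rw [aeval_eq_sum_range]
  refine Valuation.map_sum_le _ fun i _ => ?_
  rw [Algebra.smul_def, map_mul, map_pow]
  exact mul_le_one' (P.val_const_le _) (pow_le_one' hz _)

end Point

/-! ### Points at finite distance -/

namespace Point

variable {P : E.Point}

theorem val_x_le_one_of_lt {a : K} (h : P.val (E.x - algebraMap K E.FunctionField a) < 1) :
    P.val E.x ≤ 1 := by
  have := P.val.map_add_le (g := 1) h.le (P.val_const_le a)
  simpa using this

theorem val_y_le_one (h : P.val E.x ≤ 1) : P.val E.y ≤ 1 := by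
  have h1 : P.val (E.y ^ E.n) ≤ 1 := by
    rw [y_pow, aeval_eq_sum_range]
    refine Valuation.map_sum_le _ fun i _ => ?_
    rw [Algebra.smul_def, map_mul, map_pow]
    exact mul_le_one' (P.val_const_le _) (pow_le_one' h _)
  rw [map_pow] at h1
  exact (pow_le_one_iff E.n_pos.ne').1 h1

theorem val_aeval_x_le_one (h : P.val E.x ≤ 1) (p : K[X]) : P.val (aeval E.x p) ≤ 1 := by
  rw [aeval_eq_sum_range]
  refine Valuation.map_sum_le _ fun i _ => ?_
  rw [Algebra.smul_def, map_mul, map_pow]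
  exact mul_le_one' (P.val_const_le _) (pow_le_one' h _)

theorem val_algebraMap_le_one (h : P.val E.x ≤ 1) (u : E.CoordinateRing) :
    P.val (algebraMap _ E.FunctionField u) ≤ 1 := by
  obtain ⟨p, hp⟩ := E.exists_eq_sum u
  rw [hp]
  refine Valuation.map_sum_le _ fun i _ => ?_
  rw [map_mul, map_pow]
  exact mul_le_one' (pow_le_one' (val_y_le_one h) _) (val_aeval_x_le_one h _)

theorem HasCoordinates.val_x_le_one {a b : K} (h : P.HasCoordinates a b) : P.val E.x ≤ 1 :=
  val_x_le_one_of_lt h.1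

theorem HasCoordinates.equation {a b : K} (h : P.HasCoordinates a b) : b ^ E.n = E.f.eval a := by
  have hx := h.val_x_le_one
  have h1 := P.val_aeval_sub_lt_one hx h.1 E.f
  have h2 := P.val_aeval_sub_lt_one (val_y_le_one hx) h.2 (X ^ E.n)
  simp only [map_pow, aeval_X, eval_pow, eval_X] at h2
  rw [y_pow, ← map_pow] at h2
  rw [← sub_eq_zero]
  apply P.const_eq_zero_of_val_lt_one
  have := Valuation.map_sub_lt _ h1 h2
  rwa [sub_sub_sub_cancel_left, ← map_sub] at this

theorem hasCoordinates_unique {a b a' b' : K} (h : P.HasCoordinates a b)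
    (h' : P.HasCoordinates a' b') : a = a' ∧ b = b' := by
  constructor
  all_goals
    rw [eq_comm, ← sub_eq_zero]
    apply P.const_eq_zero_of_val_lt_one
  · have := Valuation.map_sub_lt _ h.1 h'.1
    rwa [sub_sub_sub_cancel_left, ← map_sub] at this
  · have := Valuation.map_sub_lt _ h.2 h'.2
    rwa [sub_sub_sub_cancel_left, ← map_sub] at this

variable [IsAlgClosed K]

theorem exists_hasCoordinates_of_val_lt_one {a : K}
    (h : P.val (E.x - algebraMap K E.FunctionField a) < 1) :
    ∃ b, P.HasCoordinates a b := by
  have hx := val_x_le_one_of_lt h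
  have hp : (X ^ E.n - C (E.f.eval a) : K[X]) ≠ 0 := (monic_X_pow_sub_C _ E.n_pos.ne').ne_zero
  obtain ⟨b, -, hb⟩ := P.exists_val_sub_lt_one hp (val_y_le_one hx) (by
    simpa [E.y_pow] using P.val_aeval_sub_lt_one hx h E.f)
  exact ⟨b, h, hb⟩

/-- If no `x - a` vanished at `P`, every nonzero polynomial in `x` would be a unit there. So would
every nonzero element of the coordinate ring, since it divides such a polynomial, and the valuation
would be trivial. -/
theorem exists_hasCoordinates (hx : P.val E.x ≤ 1) : ∃ a b, P.HasCoordinates a b := by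
  by_contra! hcon
  have h1 : ∀ a : K, P.val (E.x - algebraMap K E.FunctionField a) = 1 := by
    intro a
    refine le_antisymm (P.val.map_sub_le hx (P.val_const_le a)) (not_lt.1 fun h => ?_)
    obtain ⟨b, hb⟩ := exists_hasCoordinates_of_val_lt_one h
    exact hcon a b hb
  have h2 : ∀ p : K[X], p ≠ 0 → P.val (aeval E.x p) = 1 := fun p hp => by
    rw [P.val_aeval_of_forall h1 hp, one_pow]
  have h3 : ∀ u : E.CoordinateRing, u ≠ 0 → P.val (algebraMap _ E.FunctionField u) = 1 := by
    intro u hu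
    obtain ⟨w, p, hp, e⟩ := E.exists_mul_eq_aeval hu
    refine le_antisymm (val_algebraMap_le_one hx u) ?_
    rw [← h2 p hp, ← e, map_mul]
    exact mul_le_of_le_one_right' (val_algebraMap_le_one hx w)
  obtain ⟨h, hh, hord⟩ := P.exists_ord_eq 1
  obtain ⟨u, p, hp, rfl⟩ := E.exists_eq_div h
  have hu : u ≠ 0 := by
    rintro rfl
    simp at hh
  have h4 : P.val (algebraMap _ E.FunctionField u / aeval E.x p) = 1 := by
    rw [map_div₀, h3 u hu, h2 p hp, div_one]
  rw [P.val_eq_one_iff hh, hord] at h4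
  omega

/-- Every point is at infinity or has affine coordinates. -/
theorem isAtInfinity_or_exists_hasCoordinates (P : E.Point) :
    P.IsAtInfinity ∨ ∃ a b, P.HasCoordinates a b := by
  rcases lt_or_ge 1 (P.val E.x) with h | h
  · exact Or.inl h
  · exact Or.inr (exists_hasCoordinates h)

end Point

/-! ### The local ring at a point at finite distance -/

open Point

/-- Division by `y - b` and then by `x - a`: these two functions generate the maximal ideal of `(a,
b)`. -/
theorem exists_eq_const_add (u : E.CoordinateRing) (a b : K) : ∃ (c : K) (u₁ u₂ : E.CoordinateRing),
    algebraMap _ E.FunctionField u = algebraMap K E.FunctionField c +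
      (E.x - algebraMap K E.FunctionField a) * algebraMap _ E.FunctionField u₁ +
      (E.y - algebraMap K E.FunctionField b) * algebraMap _ E.FunctionField u₂ := by
  obtain ⟨g, rfl⟩ := AdjoinRoot.mk_surjective u
  obtain ⟨q, hq⟩ := X_sub_C_dvd_sub_C_eval (p := g) (a := C b)
  obtain ⟨r, hr⟩ := X_sub_C_dvd_sub_C_eval (p := g.eval (C b)) (a := a)
  have e : g = C (C ((g.eval (C b)).eval a)) + C (X - C a) * C r + (X - C (C b)) * q := by
    rw [← hq, ← C_mul, ← hr, C_sub]
    ring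
  have hC : ∀ c : K, algebraMap E.CoordinateRing E.FunctionField
      (AdjoinRoot.of E.equation (C c)) = algebraMap K E.FunctionField c := fun c => by
    rw [algebraMap_polynomial, aeval_C]
  refine ⟨(g.eval (C b)).eval a, AdjoinRoot.of E.equation r, AdjoinRoot.mk E.equation q, ?_⟩
  conv_lhs => rw [e]
  simp only [map_add, map_mul, map_sub, AdjoinRoot.mk_C, AdjoinRoot.mk_X, hC]
  rfl

/-- If `w (x - a)` and `w (y - b)` are multiples of `t` in the coordinate ring, with `t` vanishing
at `(a, b)` and `w` not, then so is `w u` for each `u` vanishing at `(a, b)`. -/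
theorem exists_mul_eq_mul {P : E.Point} {a b : K} {t w w₁ w₂ : E.CoordinateRing}
    (hP : P.HasCoordinates a b)
    (h₁ : algebraMap _ E.FunctionField w * (E.x - algebraMap K _ a) =
      algebraMap _ E.FunctionField t * algebraMap _ E.FunctionField w₁)
    (h₂ : algebraMap _ E.FunctionField w * (E.y - algebraMap K _ b) =
      algebraMap _ E.FunctionField t * algebraMap _ E.FunctionField w₂)
    {u : E.CoordinateRing} (hu : P.val (algebraMap _ E.FunctionField u) < 1) :
    ∃ u' : E.CoordinateRing, w * u = t * u' := by
  obtain ⟨c, u₁, u₂, e⟩ := exists_eq_const_add u a b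
  have hle := val_algebraMap_le_one hP.val_x_le_one
  have hc : c = 0 := by
    apply P.const_eq_zero_of_val_lt_one
    rw [add_assoc, ← sub_eq_iff_eq_add] at e
    rw [← e]
    refine Valuation.map_sub_lt _ hu (Valuation.map_add_lt _ ?_ ?_)
    · rw [map_mul]; exact mul_lt_one_of_lt_of_le hP.1 (hle _)
    · rw [map_mul]; exact mul_lt_one_of_lt_of_le hP.2 (hle _)
  refine ⟨w₁ * u₁ + w₂ * u₂, IsFractionRing.injective E.CoordinateRing E.FunctionField ?_⟩
  rw [map_mul, e, hc]
  simp only [map_zero, map_add, map_mul]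
  linear_combination algebraMap _ E.FunctionField u₁ * h₁ + algebraMap _ E.FunctionField u₂ * h₂

theorem algebraMap_ne_zero {u : E.CoordinateRing} (hu : u ≠ 0) :
    algebraMap _ E.FunctionField u ≠ 0 := by simpa using hu

theorem Point.HasCoordinates.ord_nonneg {P : E.Point} {a b : K} (hP : P.HasCoordinates a b)
    {u : E.CoordinateRing} (hu : u ≠ 0) : 0 ≤ P.ord (algebraMap _ E.FunctionField u) :=
  (P.val_le_one_iff (algebraMap_ne_zero hu)).1 (val_algebraMap_le_one hP.val_x_le_one u)

variable (E) in
/-- `t` generates the maximal ideal of the local ring of the affine curve at `(a, b)`. -/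
def IsLocalParameter (a b : K) (t : E.CoordinateRing) : Prop :=
  t ≠ 0 ∧ ∃ w : E.CoordinateRing, w ≠ 0 ∧
    (∀ P : E.Point, P.HasCoordinates a b → P.ord (algebraMap _ E.FunctionField w) = 0 ∧
      0 < P.ord (algebraMap _ E.FunctionField t)) ∧
    ∀ P : E.Point, P.HasCoordinates a b → ∀ u : E.CoordinateRing,
      P.val (algebraMap _ E.FunctionField u) < 1 → ∃ u', w * u = t * u'

namespace IsLocalParameter

variable {a b : K} {t : E.CoordinateRing}

/-- One quotient `u'` serves every point `Q` above `(a, b)`. This uniformity allows two valuations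
to be compared before they are known to coincide. -/
theorem exists_ord_eq (ht : E.IsLocalParameter a b t) {P : E.Point} (hP : P.HasCoordinates a b)
    {u : E.CoordinateRing} (hu : u ≠ 0) (h0 : 0 < P.ord (algebraMap _ E.FunctionField u)) :
    ∃ u' : E.CoordinateRing, u' ≠ 0 ∧ ∀ Q : E.Point, Q.HasCoordinates a b →
      Q.ord (algebraMap _ E.FunctionField u) =
        Q.ord (algebraMap _ E.FunctionField t) + Q.ord (algebraMap _ E.FunctionField u') := by
  obtain ⟨ht0, w, hw, hv, hdvd⟩ := ht
  obtain ⟨u', e⟩ := hdvd P hP u ((P.val_lt_one_iff (algebraMap_ne_zero hu)).2 h0)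
  have hu' : u' ≠ 0 := by
    rintro rfl
    rw [mul_zero] at e
    exact mul_ne_zero hw hu e
  refine ⟨u', hu', fun Q hQ => ?_⟩
  have := congrArg (fun z => Q.ord (algebraMap _ E.FunctionField z)) e
  simp only [map_mul] at this
  rwa [Q.ord_mul (algebraMap_ne_zero hw) (algebraMap_ne_zero hu),
    Q.ord_mul (algebraMap_ne_zero ht0) (algebraMap_ne_zero hu'), (hv Q hQ).1, zero_add] at this

theorem ord_pos (ht : E.IsLocalParameter a b t) {P : E.Point} (hP : P.HasCoordinates a b) :
    0 < P.ord (algebraMap _ E.FunctionField t) := by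
  obtain ⟨-, w, -, hv, -⟩ := ht
  exact (hv P hP).2

/-- Splitting off `t` repeatedly shows that all orders at `P` are multiples of that of `t`, and the
value `1` is attained. -/
theorem ord_eq_one (ht : E.IsLocalParameter a b t) {P : E.Point} (hP : P.HasCoordinates a b) :
    P.ord (algebraMap _ E.FunctionField t) = 1 := by
  have htP := ht.ord_pos hP
  have main : ∀ (m : ℕ) (u : E.CoordinateRing), u ≠ 0 →
      P.ord (algebraMap _ E.FunctionField u) = m →
      P.ord (algebraMap _ E.FunctionField t) ∣ P.ord (algebraMap _ E.FunctionField u) := by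
    intro m
    induction m using Nat.strong_induction_on with
    | _ m ih =>
    intro u hu hm
    rcases Nat.eq_zero_or_pos m with rfl | hpos
    · rw [hm]; exact dvd_zero _
    obtain ⟨u', hu', e⟩ := ht.exists_ord_eq hP hu (by omega)
    have e := e P hP
    have hn := hP.ord_nonneg hu'
    rw [e]
    refine dvd_add dvd_rfl (ih (P.ord (algebraMap _ E.FunctionField u')).toNat ?_ u' hu' ?_) <;>
      omega
  have dvd : ∀ u : E.CoordinateRing, u ≠ 0 →
      P.ord (algebraMap _ E.FunctionField t) ∣ P.ord (algebraMap _ E.FunctionField u) :=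
    fun u hu => main _ u hu (Int.toNat_of_nonneg (hP.ord_nonneg hu)).symm
  obtain ⟨h, hh, hord⟩ := P.exists_ord_eq 1
  obtain ⟨u, w, hw, rfl⟩ := IsFractionRing.div_surjective (A := E.CoordinateRing) h
  have hw0 : w ≠ 0 := nonZeroDivisors.ne_zero hw
  have hu0 : u ≠ 0 := by
    rintro rfl
    simp at hh
  rw [P.ord_div (algebraMap_ne_zero hu0) (algebraMap_ne_zero hw0)] at hord
  have := hord ▸ dvd_sub (dvd u hu0) (dvd w hw0)
  exact Int.eq_one_of_dvd_one htP.le this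

theorem point_unique (ht : E.IsLocalParameter a b t) {P Q : E.Point} (hP : P.HasCoordinates a b)
    (hQ : Q.HasCoordinates a b) : P = Q := by
  have htP := ht.ord_eq_one hP
  have htQ := ht.ord_eq_one hQ
  have main : ∀ (m : ℕ) (u : E.CoordinateRing), u ≠ 0 →
      P.ord (algebraMap _ E.FunctionField u) = m →
      P.ord (algebraMap _ E.FunctionField u) = Q.ord (algebraMap _ E.FunctionField u) := by
    intro m
    induction m with
    | zero =>
      intro u hu hm
      by_contra hne
      have hq := hQ.ord_nonneg hu
      -- If `u` vanished at `Q`, it would be divisible by `t` up to a local unit, hence vanish at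
      -- `P` as well.
      obtain ⟨u', hu', e⟩ := ht.exists_ord_eq hQ hu (by omega)
      have e := e P hP
      have := hP.ord_nonneg hu'
      omega
    | succ m ih =>
      intro u hu hm
      obtain ⟨u', hu', e⟩ := ht.exists_ord_eq hP hu (by omega)
      have eP := e P hP
      have eQ := e Q hQ
      have := ih u' hu' (by omega)
      omega
  exact Point.eq_of_ord fun u hu => main _ u hu (Int.toNat_of_nonneg (hP.ord_nonneg hu)).symm

end IsLocalParameter

theorem isLocalParameter_of_mul_eq {a b : K} {t w w₁ w₂ : E.CoordinateRing} (ht : t ≠ 0)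
    (hw : w ≠ 0)
    (h₁ : algebraMap _ E.FunctionField w * (E.x - algebraMap K _ a) =
      algebraMap _ E.FunctionField t * algebraMap _ E.FunctionField w₁)
    (h₂ : algebraMap _ E.FunctionField w * (E.y - algebraMap K _ b) =
      algebraMap _ E.FunctionField t * algebraMap _ E.FunctionField w₂)
    (hv : ∀ P : E.Point, P.HasCoordinates a b → P.val (algebraMap _ E.FunctionField w) = 1 ∧
      P.val (algebraMap _ E.FunctionField t) < 1) : E.IsLocalParameter a b t :=
  ⟨ht, w, hw, fun P hP => ⟨(P.val_eq_one_iff (algebraMap_ne_zero hw)).1 (hv P hP).1,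
    (P.val_lt_one_iff (algebraMap_ne_zero ht)).1 (hv P hP).2⟩,
    fun _ hP _ hu => exists_mul_eq_mul hP h₁ h₂ hu⟩

theorem Point.val_eq_one_of_sub_const {P : E.Point} {h : E.FunctionField} {c : K} (hc : c ≠ 0)
    (hlt : P.val (h - algebraMap K E.FunctionField c) < 1) : P.val h = 1 := by
  rw [← P.map_const c hc] at hlt
  have := P.val.map_add_eq_of_lt_left hlt
  rwa [add_sub_cancel, P.map_const c hc] at this

/-- At a point with `y ≠ 0` the function `x - a` is a local parameter. -/
theorem Point.HasCoordinates.isLocalParameter_x {P : E.Point} {a b : K}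
    (hP : P.HasCoordinates a b) (hb : b ≠ 0) :
    E.IsLocalParameter a b (AdjoinRoot.of E.equation (X - C a)) := by
  obtain ⟨q, hq⟩ := X_sub_C_dvd_sub_C_eval (p := E.f) (a := a)
  let Y := AdjoinRoot.root E.equation
  let β := algebraMap K E.CoordinateRing b
  have hβ : algebraMap _ E.FunctionField β = algebraMap K _ b :=
    (IsScalarTower.algebraMap_apply _ _ _ _).symm
  -- This is `(y ^ n - b ^ n) / (y - b)`, with the nonzero value `n b ^ (n - 1)` at `(a, b)`. Then
  -- `w (y - b) = f(x) - f(a)` is a multiple of `x - a`.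
  let w : E.CoordinateRing := ∑ k ∈ Finset.range E.n, Y ^ k * β ^ (E.n - 1 - k)
  have hw1 : ∀ P : E.Point, P.HasCoordinates a b →
      P.val (algebraMap _ E.FunctionField w) = 1 := by
    intro P hP
    refine Point.val_eq_one_of_sub_const (c := E.n * b ^ (E.n - 1))
      (mul_ne_zero E.natCast_n_ne_zero (pow_ne_zero _ hb)) ?_
    have := P.val_aeval_sub_lt_one (val_y_le_one hP.val_x_le_one) hP.2
      (∑ k ∈ Finset.range E.n, X ^ k * C b ^ (E.n - 1 - k))
    have h1 : (∑ k ∈ Finset.range E.n, b ^ k * b ^ (E.n - 1 - k)) = E.n * b ^ (E.n - 1) := by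
      rw [Finset.sum_congr rfl (g := fun _ => b ^ (E.n - 1)) fun k hk => by
        rw [← pow_add]; congr 1; have := Finset.mem_range.1 hk; omega]
      simp
    simp only [map_sum, map_mul, map_pow, aeval_X, aeval_C, eval_finsetSum, eval_mul, eval_pow,
      eval_X, eval_C] at this
    simp only [← map_pow, ← map_mul, ← map_sum, h1] at this
    simpa [w, hβ, y, Y] using this
  have ht : AdjoinRoot.of E.equation (X - C a) ≠ 0 := fun h =>
    X_sub_C_ne_zero a (E.of_injective (by rw [h, map_zero]))
  have hw : w ≠ 0 := by
    intro h
    have := hw1 P hP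
    rw [h, map_zero, map_zero] at this
    exact zero_ne_one this
  refine isLocalParameter_of_mul_eq (w₁ := w) (w₂ := AdjoinRoot.of E.equation q) ht hw ?_ ?_
    fun P hP => ⟨hw1 P hP, ?_⟩
  · rw [algebraMap_polynomial]; simp [mul_comm]
  · rw [algebraMap_polynomial, algebraMap_polynomial, ← map_mul, ← hq, map_sub, ← y_pow, ← hP.equation,
      aeval_C, map_pow, ← (Commute.all E.y (algebraMap K E.FunctionField b)).geom_sum₂_mul E.n]
    simp [w, hβ, y, Y]
  · rw [algebraMap_polynomial]; simpa using hP.1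

theorem f_eq_mul (i : Fin E.d) :
    E.f = (X + C (E.α i)) * ∏ j ∈ Finset.univ.erase i, (X + C (E.α j)) :=
  (Finset.mul_prod_erase _ _ (Finset.mem_univ i)).symm

theorem eval_prod_erase_ne_zero (i : Fin E.d) :
    (∏ j ∈ Finset.univ.erase i, (X + C (E.α j))).eval (-E.α i) ≠ 0 := by
  rw [eval_prod, Finset.prod_ne_zero_iff]
  intro j hj h
  simp only [eval_add, eval_X, eval_C] at h
  exact Finset.ne_of_mem_erase hj (E.α_injective (by linear_combination h))

theorem eval_f_eq_zero_iff {a : K} : E.f.eval a = 0 ↔ ∃ i, a = -E.α i := by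
  rw [f, eval_prod, Finset.prod_eq_zero_iff]
  simp [add_eq_zero_iff_eq_neg]

theorem Point.HasCoordinates.val_aeval {P : E.Point} {a b : K} (hP : P.HasCoordinates a b)
    {p : K[X]} (hp : p.eval a ≠ 0) : P.val (aeval E.x p) = 1 :=
  val_eq_one_of_sub_const hp (P.val_aeval_sub_lt_one hP.val_x_le_one hP.1 p)

/-- At a point with `y = 0` the function `y` is a local parameter. -/
theorem isLocalParameter_y (i : Fin E.d) :
    E.IsLocalParameter (-E.α i) 0 (AdjoinRoot.root E.equation) := by
  set q := ∏ j ∈ Finset.univ.erase i, (X + C (E.α j)) with hq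
  have hq0 : q ≠ 0 := (monic_prod_of_monic _ _ fun _ _ => monic_X_add_C _).ne_zero
  have ht : AdjoinRoot.root E.equation ≠ 0 := fun h => E.y_ne_zero (by rw [y, h, map_zero])
  have hw : AdjoinRoot.of E.equation q ≠ 0 := fun h => hq0 (E.of_injective (by rw [h, map_zero]))
  -- Here `w = q(x)`, the product of the other factors of `f`, is a unit at the point, and `q(x) (x
  -- + α_i) = y ^ n`.
  refine isLocalParameter_of_mul_eq (w₁ := AdjoinRoot.root E.equation ^ (E.n - 1))
    (w₂ := AdjoinRoot.of E.equation q) ht hw ?_ ?_ fun P hP => ⟨?_, ?_⟩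
  · have h1 := E.y_pow
    rw [f_eq_mul i, ← hq, ← Nat.sub_add_cancel E.n_pos, pow_succ', map_mul] at h1
    simp only [map_add, aeval_X, aeval_C] at h1
    rw [algebraMap_polynomial, map_pow, map_neg, sub_neg_eq_add, mul_comm, ← h1]
    rfl
  · rw [map_zero, sub_zero, mul_comm]
    rfl
  · rw [algebraMap_polynomial]
    exact hP.val_aeval (eval_prod_erase_ne_zero i)
  · have := hP.2
    rwa [map_zero, sub_zero] at this

/-- A point at finite distance is determined by its coordinates. -/
theorem Point.eq_of_hasCoordinates {P Q : E.Point} {a b : K} (hP : P.HasCoordinates a b)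
    (hQ : Q.HasCoordinates a b) : P = Q := by
  rcases eq_or_ne b 0 with rfl | hb
  · have h := hP.equation
    rw [zero_pow E.n_pos.ne', eq_comm, eval_f_eq_zero_iff] at h
    obtain ⟨i, rfl⟩ := h
    exact (isLocalParameter_y i).point_unique hP hQ
  · exact (hP.isLocalParameter_x hb).point_unique hP hQ

theorem Point.HasCoordinates.ord_x_sub {P : E.Point} {a b : K} (hP : P.HasCoordinates a b)
    (hb : b ≠ 0) : P.ord (E.x - algebraMap K E.FunctionField a) = 1 := by
  have := (hP.isLocalParameter_x hb).ord_eq_one hP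
  rw [algebraMap_polynomial] at this
  simpa using this

theorem Point.HasCoordinates.ord_y {P : E.Point} {i : Fin E.d}
    (hP : P.HasCoordinates (-E.α i) 0) : P.ord E.y = 1 :=
  (isLocalParameter_y i).ord_eq_one hP

theorem Point.HasCoordinates.ord_y_of_ne_zero {P : E.Point} {a b : K}
    (hP : P.HasCoordinates a b) (hb : b ≠ 0) : P.ord E.y = 0 :=
  (P.val_eq_one_iff E.y_ne_zero).1 (val_eq_one_of_sub_const hb hP.2)

theorem Point.HasCoordinates.ord_x_sub_of_zero {P : E.Point} {i : Fin E.d}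
    (hP : P.HasCoordinates (-E.α i) 0) :
    P.ord (E.x - algebraMap K E.FunctionField (-E.α i)) = E.n := by
  set q := ∏ j ∈ Finset.univ.erase i, (X + C (E.α j)) with hq
  have hq0 : q ≠ 0 := (monic_prod_of_monic _ _ fun _ _ => monic_X_add_C _).ne_zero
  have h1 := congrArg P.ord E.y_pow
  have h2 := (P.val_eq_one_iff (E.aeval_x_ne_zero hq0)).1
    (hP.val_aeval (eval_prod_erase_ne_zero i))
  rw [P.ord_pow, hP.ord_y, f_eq_mul i, ← hq, map_mul, map_add, aeval_X, aeval_C,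
    P.ord_mul (by simpa using E.x_sub_ne_zero (-E.α i)) (E.aeval_x_ne_zero hq0), h2] at h1
  simp only [map_neg, sub_neg_eq_add]
  omega

theorem Point.HasCoordinates.ord_x_sub_of_ne {P : E.Point} {a b c : K}
    (hP : P.HasCoordinates a b) (hc : a ≠ c) :
    P.ord (E.x - algebraMap K E.FunctionField c) = 0 := by
  rw [← P.val_eq_one_iff (E.x_sub_ne_zero c)]
  have := hP.val_aeval (p := X - C c) (by simpa [sub_eq_zero] using hc)
  simpa using this

/-! ### The point at infinity -/

namespace Point.IsAtInfinity

variable {P : E.Point} (hP : P.IsAtInfinity)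
include hP

theorem val_x_sub (β : K) : P.val (E.x - algebraMap K E.FunctionField β) = P.val E.x :=
  P.val.map_sub_eq_of_lt_left ((P.val_const_le β).trans_lt hP)

variable [IsAlgClosed K]

theorem ord_aeval {p : K[X]} (hp : p ≠ 0) : P.ord (aeval E.x p) = p.natDegree * P.ord E.x := by
  rw [ord, ord, P.val_aeval_of_forall hP.val_x_sub hp, WithZero.log_pow]
  simp

/-- Comparing orders in `y ^ n = f(x)` gives `n ord(y) = d ord(x)`, and coprimality yields `n ∣
ord(x)`. That `m = 1` needs the orders of all functions. -/
theorem exists_ord_eq : ∃ m : ℤ, 0 < m ∧ P.ord E.x = -(E.n * m) ∧ P.ord E.y = -(E.d * m) := by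
  have hx0 : E.x ≠ 0 := by simpa using E.aeval_x_ne_zero X_ne_zero
  have hx : P.ord E.x < 0 := by
    by_contra h
    exact absurd hP (not_lt.2 ((P.val_le_one_iff hx0).2 (not_lt.1 h)))
  have h1 := congrArg P.ord E.y_pow
  rw [P.ord_pow, hP.ord_aeval E.f_monic.ne_zero, E.natDegree_f] at h1
  have hcop : IsCoprime (E.n : ℤ) (E.d : ℤ) := Nat.isCoprime_iff_coprime.2 E.coprime
  obtain ⟨m, hm⟩ : (E.n : ℤ) ∣ P.ord E.x := hcop.dvd_of_dvd_mul_left ⟨_, h1.symm⟩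
  have hn : (0 : ℤ) < E.n := by exact_mod_cast E.n_pos
  refine ⟨-m, ?_, by rw [hm]; ring, ?_⟩
  · rw [hm] at hx
    by_contra hcon
    nlinarith
  · rw [hm] at h1
    have : (E.n : ℤ) * P.ord E.y = E.n * (E.d * m) := by rw [h1]; ring
    rw [mul_left_cancel₀ hn.ne' this]
    ring

omit hP in
/-- The pole orders at infinity of `y ^ j * p(x)`, for `j < n`, are distinct. -/
theorem exists_ord_algebraMap {u : E.CoordinateRing} (hu : u ≠ 0) : ∃ N : ℕ, ∀ {P : E.Point},
    P.IsAtInfinity → ∀ {m : ℤ}, 0 < m → P.ord E.x = -(E.n * m) → P.ord E.y = -(E.d * m) →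
      P.ord (algebraMap _ E.FunctionField u) = -(N * m) := by
  classical
  obtain ⟨p, hp⟩ := E.exists_eq_sum u
  let S := (Finset.range E.n).filter fun j => p j ≠ 0
  have hS : S.Nonempty := by
    rw [Finset.nonempty_iff_ne_empty]
    intro h
    refine algebraMap_ne_zero hu (hp.trans (Finset.sum_eq_zero fun j hj => ?_))
    have : p j = 0 := by
      by_contra h0
      exact Finset.notMem_empty j (h ▸ Finset.mem_filter.2 ⟨hj, h0⟩)
    rw [this, map_zero, mul_zero]
  let N : ℕ → ℕ := fun j => j * E.d + E.n * (p j).natDegree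
  obtain ⟨j₀, hj₀, hmax⟩ := S.exists_max_image N hS
  refine ⟨N j₀, fun {P} hP {m} hm hx hy => ?_⟩
  have hord : ∀ j ∈ S, P.ord (E.y ^ j * aeval E.x (p j)) = -(N j * m) := by
    intro j hj
    have hpj := (Finset.mem_filter.1 hj).2
    rw [P.ord_mul (pow_ne_zero _ E.y_ne_zero) (E.aeval_x_ne_zero hpj), P.ord_pow, hP.ord_aeval hpj,
      hx, hy]
    simp only [N]
    push_cast
    ring
  have hne : ∀ j ∈ S, E.y ^ j * aeval E.x (p j) ≠ 0 := fun j hj =>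
    mul_ne_zero (pow_ne_zero _ E.y_ne_zero) (E.aeval_x_ne_zero (Finset.mem_filter.1 hj).2)
  -- Modulo `n` the pole order `N j` is `j d`, and `d` is invertible modulo `n`. Hence a single term
  -- dominates the sum.
  have hinj : ∀ j ∈ S, N j = N j₀ → j = j₀ := by
    intro j hj h
    have h1 := Finset.mem_range.1 (Finset.mem_filter.1 hj).1
    have h2 := Finset.mem_range.1 (Finset.mem_filter.1 hj₀).1
    have h3 : j * E.d ≡ j₀ * E.d [MOD E.n] := by
      have : N j ≡ N j₀ [MOD E.n] := by rw [h]
      simpa [N, Nat.ModEq] using this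
    exact (Nat.ModEq.cancel_right_of_coprime E.coprime h3).eq_of_lt_of_lt h1 h2
  have hval : P.val (algebraMap _ E.FunctionField u) = P.val (E.y ^ j₀ * aeval E.x (p j₀)) := by
    rw [hp]
    refine P.val.map_sum_eq_of_lt
      (f := fun j => E.y ^ j * aeval E.x (p j)) (Finset.mem_filter.1 hj₀).1
      fun j hj => ?_
    obtain ⟨hj1, hj2⟩ := Finset.mem_sdiff.1 hj
    rw [Finset.mem_singleton] at hj2
    by_cases hjS : j ∈ S
    · rw [P.val_eq_exp (hne _ hj₀), P.val_eq_exp (hne j hjS), WithZero.exp_lt_exp, hord j hjS,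
        hord j₀ hj₀, neg_neg, neg_neg]
      have h1 := hmax j hjS
      have h2 : N j ≠ N j₀ := fun h => hj2 (hinj j hjS h)
      exact mul_lt_mul_of_pos_right (by exact_mod_cast lt_of_le_of_ne h1 h2) hm
    · have : p j = 0 := by
        by_contra h0
        exact hjS (Finset.mem_filter.2 ⟨hj1, h0⟩)
      rw [this, map_zero, mul_zero, map_zero]
      exact zero_lt_iff.2 (P.val_ne_zero (hne _ hj₀))
  rw [ord, hval]
  exact hord j₀ hj₀

/-- Every order at `P` is a multiple of `m`, and the order `1` occurs, so `m = 1`. -/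
theorem ord_x_and_ord_y : P.ord E.x = -E.n ∧ P.ord E.y = -E.d := by
  obtain ⟨m, hm, hx, hy⟩ := hP.exists_ord_eq
  have dvd : ∀ u : E.CoordinateRing, u ≠ 0 → m ∣ P.ord (algebraMap _ E.FunctionField u) := by
    intro u hu
    obtain ⟨N, hN⟩ := exists_ord_algebraMap hu
    exact ⟨-N, by rw [hN hP hm hx hy]; ring⟩
  obtain ⟨h, hh, hord⟩ := Point.exists_ord_eq P 1
  obtain ⟨u, w, hw, rfl⟩ := IsFractionRing.div_surjective (A := E.CoordinateRing) h
  have hw0 : w ≠ 0 := nonZeroDivisors.ne_zero hw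
  have hu0 : u ≠ 0 := by
    rintro rfl
    simp at hh
  rw [P.ord_div (algebraMap_ne_zero hu0) (algebraMap_ne_zero hw0)] at hord
  have := hord ▸ dvd_sub (dvd u hu0) (dvd w hw0)
  have hm1 := Int.eq_one_of_dvd_one hm.le this
  rw [hx, hy, hm1, mul_one, mul_one]
  exact ⟨rfl, rfl⟩

/-- With `m = 1`, the order of `u` at infinity is `-N`, where `N` depends on `u` alone. -/
theorem eq {Q : E.Point} (hQ : Q.IsAtInfinity) : P = Q := by
  refine Point.eq_of_ord fun u hu => ?_
  obtain ⟨N, hN⟩ := exists_ord_algebraMap hu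
  rw [hN hP one_pos (by rw [hP.ord_x_and_ord_y.1, mul_one]) (by rw [hP.ord_x_and_ord_y.2, mul_one]),
    hN hQ one_pos (by rw [hQ.ord_x_and_ord_y.1, mul_one]) (by rw [hQ.ord_x_and_ord_y.2, mul_one])]

theorem ord_x_sub (c : K) : P.ord (E.x - algebraMap K E.FunctionField c) = -E.n := by
  rw [ord, hP.val_x_sub, ← hP.ord_x_and_ord_y.1, ord]

end Point.IsAtInfinity

variable [IsAlgClosed K]

variable (E) in
theorem existsUnique_isAtInfinity : ∃! O : E.Point, O.IsAtInfinity := by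
  obtain ⟨O, hO⟩ := E.exists_isAtInfinity
  exact ⟨O, hO, fun Q hQ => Point.IsAtInfinity.eq hQ hO⟩

theorem existsUnique_hasCoordinates (i : Fin E.d) :
    ∃! P : E.Point, P.HasCoordinates (-E.α i) 0 := by
  obtain ⟨P, hP⟩ := E.exists_val_x_sub_lt_one (-E.α i)
  obtain ⟨b, hb⟩ := Point.exists_hasCoordinates_of_val_lt_one hP
  have h := hb.equation
  rw [eval_f_eq_zero_iff.2 ⟨i, rfl⟩, pow_eq_zero_iff E.n_pos.ne'] at h
  exact ⟨P, h ▸ hb, fun Q hQ => Point.eq_of_hasCoordinates hQ (h ▸ hb)⟩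

end SuperellipticCurve

namespace SuperellipticCurve

variable {K : Type*} [Field K] {E : SuperellipticCurve K} {ζ : K} (hζ : IsPrimitiveRoot ζ E.n)

/-! ### The powers of the automorphism -/

theorem pullback_aeval_x (p : K[X]) : E.pullback hζ (aeval E.x p) = aeval E.x p := by
  rw [← algebraMap_polynomial, pullback_algebraMap]
  exact congrArg _ ((E.scaleHom hζ.pow_eq_one).commutes p)

/-- The `k`-th power of the automorphism `h ↦ h ∘ ζ` of the function field. -/
noncomputable def pullbackPow (k : ℕ) : E.FunctionField →+* E.FunctionField :=
  (E.pullback hζ : E.FunctionField →+* E.FunctionField) ^ k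

theorem pullbackPow_zero (h : E.FunctionField) : pullbackPow hζ 0 h = h := rfl

theorem pullbackPow_succ (k : ℕ) (h : E.FunctionField) :
    pullbackPow hζ (k + 1) h = E.pullback hζ (pullbackPow hζ k h) := by
  rw [pullbackPow, pow_succ']
  rfl

theorem pullbackPow_pullback (k : ℕ) (h : E.FunctionField) :
    pullbackPow hζ k (E.pullback hζ h) = pullbackPow hζ (k + 1) h := by
  rw [pullbackPow, pullbackPow, pow_succ]
  rfl

theorem pullbackPow_const (k : ℕ) (c : K) :
    pullbackPow hζ k (algebraMap K E.FunctionField c) = algebraMap K E.FunctionField c := by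
  induction k with
  | zero => rfl
  | succ k ih => rw [pullbackPow_succ, ih, pullback_const]

theorem pullbackPow_aeval_x (k : ℕ) (p : K[X]) :
    pullbackPow hζ k (aeval E.x p) = aeval E.x p := by
  induction k with
  | zero => rfl
  | succ k ih => rw [pullbackPow_succ, ih, pullback_aeval_x]

theorem pullbackPow_y (k : ℕ) :
    pullbackPow hζ k E.y = algebraMap K E.FunctionField (ζ ^ k) * E.y := by
  induction k with
  | zero => simp [pullbackPow_zero]
  | succ k ih =>
    rw [pullbackPow_succ, ih, map_mul, pullback_const, pullback_y, pow_succ, map_mul, mul_assoc]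

theorem exists_eq_sum_div (h : E.FunctionField) : ∃ (p : ℕ → K[X]) (q : K[X]), q ≠ 0 ∧
    h = (∑ j ∈ Finset.range E.n, E.y ^ j * aeval E.x (p j)) / aeval E.x q := by
  obtain ⟨u, q, hq, rfl⟩ := E.exists_eq_div h
  obtain ⟨p, hp⟩ := E.exists_eq_sum u
  exact ⟨p, q, hq, by rw [hp]⟩

/-- The terms `y ^ j p_j(x) / q(x)` are eigenvectors of the automorphism, with eigenvalue `ζ ^ j`.
-/
theorem pullbackPow_sum_div (k : ℕ) (p : ℕ → K[X]) (q : K[X]) :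
    pullbackPow hζ k ((∑ j ∈ Finset.range E.n, E.y ^ j * aeval E.x (p j)) / aeval E.x q) =
      (∑ j ∈ Finset.range E.n, algebraMap K E.FunctionField ((ζ ^ j) ^ k) *
        (E.y ^ j * aeval E.x (p j))) / aeval E.x q := by
  rw [map_div₀, pullbackPow_aeval_x, map_sum]
  congr 1
  refine Finset.sum_congr rfl fun j _ => ?_
  rw [map_mul, pullbackPow_aeval_x, map_pow, pullbackPow_y, mul_pow, ← map_pow, ← pow_mul,
    ← pow_mul, mul_comm k j, mul_assoc]

theorem pullbackPow_n (h : E.FunctionField) : pullbackPow hζ E.n h = h := by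
  obtain ⟨p, q, -, rfl⟩ := exists_eq_sum_div h
  rw [pullbackPow_sum_div]
  congr 1
  refine Finset.sum_congr rfl fun j _ => ?_
  rw [← pow_mul, mul_comm j, pow_mul, hζ.pow_eq_one, one_pow, map_one, one_mul]

-- Orthogonality of the characters of a cyclic group of order `n`; it isolates one component in the
-- averaging arguments.
include hζ in
theorem sum_pow_pow_eq {j : ℕ} (hj : j < E.n) :
    ∑ k ∈ Finset.range E.n, (ζ ^ j) ^ k = if j = 0 then (E.n : K) else 0 := by
  split_ifs with h
  · simp [h]
  · have h1 : ζ ^ j ≠ 1 := fun h0 => h (Nat.eq_zero_of_dvd_of_lt ((hζ.pow_eq_one_iff_dvd j).1 h0) hj)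
    rw [geom_sum_eq h1, ← pow_mul, mul_comm, pow_mul, hζ.pow_eq_one, one_pow, sub_self, zero_div]

/-- The functions fixed by the automorphism are the rational functions of `x`. -/
theorem exists_eq_div_of_pullback_eq {h : E.FunctionField} (hh : E.pullback hζ h = h) :
    ∃ p q : K[X], q ≠ 0 ∧ h = aeval E.x p / aeval E.x q := by
  obtain ⟨p, q, hq, e⟩ := exists_eq_sum_div h
  refine ⟨p 0, q, hq, ?_⟩
  have hfix : ∀ k, pullbackPow hζ k h = h := by
    intro k
    induction k with
    | zero => rfl
    | succ k ih => rw [pullbackPow_succ, ih, hh]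
  -- The trace of `h` is computed twice: it is `n h` by invariance, and `n` times the component `j =
  -- 0` by orthogonality.
  have h1 : ∑ k ∈ Finset.range E.n, pullbackPow hζ k h = algebraMap K _ (E.n : K) * h := by
    simp [hfix]
  have h2 : ∑ k ∈ Finset.range E.n, pullbackPow hζ k h =
      algebraMap K _ (E.n : K) * (aeval E.x (p 0) / aeval E.x q) := by
    simp_rw [e, pullbackPow_sum_div]
    rw [← Finset.sum_div, Finset.sum_comm]
    simp_rw [← Finset.sum_mul, ← map_sum]
    rw [Finset.sum_eq_single_of_mem 0 (Finset.mem_range.2 E.n_pos) fun j hj hj0 => by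
      rw [sum_pow_pow_eq hζ (Finset.mem_range.1 hj), if_neg hj0, map_zero, zero_mul]]
    rw [sum_pow_pow_eq hζ E.n_pos, if_pos rfl, pow_zero, one_mul, mul_div_assoc]
  have hn : algebraMap K E.FunctionField (E.n : K) ≠ 0 :=
    (_root_.map_ne_zero _).2 E.natCast_n_ne_zero
  exact mul_left_cancel₀ hn (h1.symm.trans h2)

theorem Point.val_pullbackPow (P : E.Point) (k : ℕ) (h : E.FunctionField) :
    P.val (pullbackPow hζ k h) = ((Point.rotate hζ)^[k] P).val h := by
  induction k generalizing h with
  | zero => rfl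
  | succ k ih =>
    rw [Function.iterate_succ', ← pullbackPow_pullback, ih]
    rfl

theorem Point.ord_pullbackPow (P : E.Point) (k : ℕ) (h : E.FunctionField) :
    P.ord (pullbackPow hζ k h) = ((Point.rotate hζ)^[k] P).ord h := by
  rw [ord, ord, val_pullbackPow]

/-! ### The norm to `K(x)` -/

/-- The norm of a function to the field of rational functions of `x`. -/
noncomputable def norm (h : E.FunctionField) : E.FunctionField :=
  ∏ k ∈ Finset.range E.n, pullbackPow hζ k h

theorem norm_mul (g h : E.FunctionField) : norm hζ (g * h) = norm hζ g * norm hζ h := by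
  simp [norm, Finset.prod_mul_distrib]

theorem norm_const (c : K) : norm hζ (algebraMap K E.FunctionField c) =
    algebraMap K E.FunctionField (c ^ E.n) := by
  simp [norm, pullbackPow_const]

theorem pullbackPow_ne_zero (k : ℕ) {h : E.FunctionField} (hh : h ≠ 0) :
    pullbackPow hζ k h ≠ 0 := (_root_.map_ne_zero _).2 hh

theorem norm_ne_zero {h : E.FunctionField} (hh : h ≠ 0) : norm hζ h ≠ 0 :=
  Finset.prod_ne_zero_iff.2 fun k _ => pullbackPow_ne_zero hζ k hh

theorem pullback_norm {h : E.FunctionField} (hh : h ≠ 0) :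
    E.pullback hζ (norm hζ h) = norm hζ h := by
  -- The product over `0, …, n` is split at either end; both extra factors equal `h`.
  have h1 := Finset.prod_range_succ (fun k => pullbackPow hζ k h) E.n
  rw [Finset.prod_range_succ', pullbackPow_n, pullbackPow_zero] at h1
  rw [norm, map_prod]
  simp_rw [← pullbackPow_succ]
  exact mul_right_cancel₀ hh h1

/-- Hilbert's Theorem 90 for the cyclic extension `K(𝒞) / K(x)`. -/
theorem exists_mul_pullback_eq {h : E.FunctionField} (hh : norm hζ h = 1) :
    ∃ g : E.FunctionField, g ≠ 0 ∧ h * E.pullback hζ g = g := by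
  let H : ℕ → E.FunctionField := fun k => ∏ i ∈ Finset.range k, pullbackPow hζ i h
  have hH : ∀ k, h * E.pullback hζ (H k) = H (k + 1) := by
    intro k
    simp only [H]
    rw [Finset.prod_range_succ', map_prod, mul_comm, pullbackPow_zero]
    simp_rw [← pullbackPow_succ]
  have hHn : H E.n = 1 := hh
  have hH0 : H 0 = 1 := Finset.prod_range_zero _
  -- The Lagrange resolvent with the partial norms `H k` as coefficients; any nonzero value of it is
  -- a suitable `g`.
  let G : E.FunctionField → E.FunctionField := fun θ =>
    ∑ k ∈ Finset.range E.n, H k * pullbackPow hζ k θ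
  have hG : ∀ θ, h * E.pullback hζ (G θ) = G θ := by
    intro θ
    simp only [G]
    rw [map_sum, Finset.mul_sum]
    simp_rw [map_mul, ← mul_assoc, hH, ← pullbackPow_succ]
    have h1 := Finset.sum_range_succ (fun k => H k * pullbackPow hζ k θ) E.n
    rw [Finset.sum_range_succ', pullbackPow_n, pullbackPow_zero, hHn, hH0] at h1
    exact add_right_cancel h1
  by_contra! hcon
  have hzero : ∀ i, ∑ k ∈ Finset.range E.n, H k * algebraMap K _ ((ζ ^ k) ^ i) = 0 := by
    intro i
    have h1 : G (E.y ^ i) = 0 := by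
      by_contra h0
      exact hcon _ h0 (hG _)
    have h2 : G (E.y ^ i) = (∑ k ∈ Finset.range E.n, H k * algebraMap K _ ((ζ ^ k) ^ i)) *
        E.y ^ i := by
      simp only [G]
      rw [Finset.sum_mul]
      refine Finset.sum_congr rfl fun k _ => ?_
      rw [map_pow, pullbackPow_y, mul_pow, map_pow _ (ζ ^ k), mul_assoc]
    rw [h2] at h1
    exact (mul_eq_zero.1 h1).resolve_right (pow_ne_zero _ E.y_ne_zero)
  -- If the resolvent vanished at all `y ^ i`, the sum of the relations `hzero i` would collapse to
  -- `n H 0 = n = 0`.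
  have hsum : ∑ i ∈ Finset.range E.n, ∑ k ∈ Finset.range E.n,
      H k * algebraMap K E.FunctionField ((ζ ^ k) ^ i) = 0 :=
    Finset.sum_eq_zero fun i _ => hzero i
  rw [Finset.sum_comm] at hsum
  simp_rw [← Finset.mul_sum, ← map_sum] at hsum
  rw [Finset.sum_eq_single_of_mem 0 (Finset.mem_range.2 E.n_pos) fun j hj hj0 => by
    rw [sum_pow_pow_eq hζ (Finset.mem_range.1 hj), if_neg hj0, map_zero, mul_zero],
    sum_pow_pow_eq hζ E.n_pos, if_pos rfl, hH0, one_mul, _root_.map_eq_zero] at hsum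
  exact E.natCast_n_ne_zero hsum

/-! ### Functions without poles are constant -/

variable [IsAlgClosed K]

theorem exists_eq_const_of_aeval_eq_zero {z : E.FunctionField} {p : K[X]} (hp : p ≠ 0)
    (hz : aeval z p = 0) : ∃ c : K, z = algebraMap K E.FunctionField c := by
  rw [(IsAlgClosed.splits p).eq_prod_roots, map_mul, aeval_C, map_multiset_prod,
    mul_eq_zero, Multiset.map_map] at hz
  rcases hz with hz | hz
  · exact absurd hz ((_root_.map_ne_zero _).2 (leadingCoeff_ne_zero.2 hp))
  · obtain ⟨c, -, hc⟩ := Multiset.mem_map.1 (Multiset.prod_eq_zero_iff.1 hz)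
    exact ⟨c, by simpa [sub_eq_zero] using hc⟩

/-- Regularity at a point above a root of `q` forces `p` to have the same root, which cancels. Once
`q` is constant, regularity at infinity forces `p` to be constant. -/
theorem exists_eq_const_of_val_div_le_one {p q : K[X]} (hq : q ≠ 0)
    (h : ∀ P : E.Point, P.val (aeval E.x p / aeval E.x q) ≤ 1) :
    ∃ c : K, aeval E.x p / aeval E.x q = algebraMap K E.FunctionField c := by
  induction hm : q.natDegree generalizing p q with
  | zero =>
    obtain ⟨c, rfl⟩ := natDegree_eq_zero.1 hm
    have hc : c ≠ 0 := by
      rintro rfl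
      exact hq (map_zero C)
    rcases eq_or_ne p 0 with rfl | hp
    · exact ⟨0, by simp⟩
    obtain ⟨O, hO⟩ := E.exists_isAtInfinity
    have h1 := h O
    rw [map_div₀, aeval_C, O.map_const c hc, div_one, O.val_le_one_iff (E.aeval_x_ne_zero hp),
      hO.ord_aeval hp, hO.ord_x_and_ord_y.1] at h1
    have hn : (0 : ℤ) < E.n := by exact_mod_cast E.n_pos
    have hdeg : p.natDegree = 0 := by
      by_contra h0
      have : (0 : ℤ) < p.natDegree := by exact_mod_cast Nat.pos_of_ne_zero h0
      nlinarith
    obtain ⟨e, rfl⟩ := natDegree_eq_zero.1 hdeg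
    exact ⟨e / c, by rw [aeval_C, aeval_C, map_div₀]⟩
  | succ m ih =>
    obtain ⟨a, ha⟩ := IsAlgClosed.exists_root q (by
      rw [degree_eq_natDegree hq, hm]
      exact_mod_cast Nat.succ_ne_zero m)
    obtain ⟨Q, hQ⟩ := E.exists_val_x_sub_lt_one a
    have hx := Point.val_x_le_one_of_lt hQ
    have hq1 : Q.val (aeval E.x q) < 1 := by
      have := Q.val_aeval_sub_lt_one hx hQ q
      rwa [ha.eq_zero, map_zero, sub_zero] at this
    have hp1 : Q.val (aeval E.x p) < 1 := by
      have h1 : aeval E.x p = (aeval E.x p / aeval E.x q) * aeval E.x q :=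
        (div_mul_cancel₀ _ (E.aeval_x_ne_zero hq)).symm
      rw [h1, mul_comm, map_mul]
      exact mul_lt_one_of_lt_of_le hq1 (h Q)
    have hpa : p.eval a = 0 := by
      apply Q.const_eq_zero_of_val_lt_one
      have := Valuation.map_sub_lt _ hp1 (Q.val_aeval_sub_lt_one hx hQ p)
      rwa [sub_sub_cancel] at this
    obtain ⟨q', rfl⟩ := dvd_iff_isRoot.2 ha
    obtain ⟨p', rfl⟩ := dvd_iff_isRoot.2 (show p.IsRoot a from hpa)
    have hq' : q' ≠ 0 := right_ne_zero_of_mul hq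
    have e : aeval E.x ((X - C a) * p') / aeval E.x ((X - C a) * q') =
        aeval E.x p' / aeval E.x q' := by
      rw [map_mul, map_mul, mul_div_mul_left _ _ (E.aeval_x_ne_zero (X_sub_C_ne_zero a))]
    rw [e]
    refine ih hq' (fun P => e ▸ h P) ?_
    rw [natDegree_mul (X_sub_C_ne_zero a) hq', natDegree_X_sub_C] at hm
    omega

include hζ in
/-- A function without poles is constant. -/
theorem exists_eq_const_of_val_le_one {u : E.FunctionField} (h : ∀ P : E.Point, P.val u ≤ 1) :
    ∃ c : K, u = algebraMap K E.FunctionField c := by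
  -- `T j` is `n` times the `ζ ^ j`-eigencomponent of `u` and again has no poles. Its `n`th power is
  -- invariant, so it is a rational function of `x` without poles, hence constant; then `T j` is
  -- algebraic over `K`, hence constant too.
  let T : ℕ → E.FunctionField := fun j =>
    ∑ k ∈ Finset.range E.n, algebraMap K _ ((ζ⁻¹ ^ j) ^ k) * pullbackPow hζ k u
  have hζ0 : ζ ≠ 0 := hζ.ne_zero E.n_pos.ne'
  have hT : ∀ j, E.pullback hζ (T j) = algebraMap K _ (ζ ^ j) * T j := by
    intro j
    have h1 := Finset.sum_range_succ
      (fun k => algebraMap K E.FunctionField ((ζ⁻¹ ^ j) ^ k) * pullbackPow hζ k u) E.n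
    rw [Finset.sum_range_succ', pullbackPow_n, pullbackPow_zero, pow_zero, ← pow_mul,
      mul_comm j, pow_mul, hζ.inv.pow_eq_one, one_pow] at h1
    have h2 := add_right_cancel h1
    simp only [T]
    conv_rhs => rw [← h2]
    rw [map_sum, Finset.mul_sum]
    refine Finset.sum_congr rfl fun k _ => ?_
    rw [map_mul, pullback_const, ← pullbackPow_succ, ← mul_assoc, ← map_mul, pow_succ',
      ← mul_assoc, ← mul_pow, mul_inv_cancel₀ hζ0, one_pow, one_mul]
  have hval : ∀ j (P : E.Point), P.val (T j) ≤ 1 := by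
    intro j P
    refine Valuation.map_sum_le _ fun k _ => ?_
    rw [map_mul, Point.val_pullbackPow]
    exact mul_le_one' (P.val_const_le _) (h _)
  have hconst : ∀ j, ∃ c : K, T j = algebraMap K _ c := by
    intro j
    obtain ⟨p, q, hq, e⟩ := exists_eq_div_of_pullback_eq hζ (h := T j ^ E.n) (by
      rw [map_pow, hT, mul_pow, ← map_pow, ← pow_mul, mul_comm j, pow_mul, hζ.pow_eq_one, one_pow,
        map_one, one_mul])
    obtain ⟨c, hc⟩ := exists_eq_const_of_val_div_le_one hq fun P => by
      rw [← e, map_pow]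
      exact pow_le_one' (hval j P) _
    refine exists_eq_const_of_aeval_eq_zero (p := X ^ E.n - C c)
      (monic_X_pow_sub_C _ E.n_pos.ne').ne_zero ?_
    rw [map_sub, map_pow, aeval_X, aeval_C, ← hc, ← e, sub_self]
  have hsum : ∑ j ∈ Finset.range E.n, T j = algebraMap K _ (E.n : K) * u := by
    simp only [T]
    rw [Finset.sum_comm]
    have : ∀ k j : ℕ, ((ζ⁻¹ ^ j) ^ k) = ((ζ⁻¹ ^ k) ^ j) := fun k j => by
      rw [← pow_mul, ← pow_mul, mul_comm]
    simp_rw [this, ← Finset.sum_mul, ← map_sum]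
    rw [Finset.sum_eq_single_of_mem 0 (Finset.mem_range.2 E.n_pos) fun j hj hj0 => by
      rw [sum_pow_pow_eq hζ.inv (Finset.mem_range.1 hj), if_neg hj0, map_zero, zero_mul],
      sum_pow_pow_eq hζ.inv E.n_pos, if_pos rfl, pullbackPow_zero]
  choose c hc using hconst
  have hn : algebraMap K E.FunctionField (E.n : K) ≠ 0 :=
    (_root_.map_ne_zero _).2 E.natCast_n_ne_zero
  refine ⟨(E.n : K)⁻¹ * ∑ j ∈ Finset.range E.n, c j, ?_⟩
  rw [map_mul, map_inv₀, map_sum, ← Finset.sum_congr rfl fun j _ => hc j, hsum,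
    inv_mul_cancel_left₀ hn]

include hζ in
theorem exists_eq_const_of_ord_eq_zero {u : E.FunctionField} (hu : u ≠ 0)
    (h : ∀ P : E.Point, P.ord u = 0) : ∃ c : K, c ≠ 0 ∧ u = algebraMap K E.FunctionField c := by
  obtain ⟨c, rfl⟩ := exists_eq_const_of_val_le_one hζ (u := u) fun P =>
    (P.val_le_one_iff hu).2 (h P).ge
  exact ⟨c, fun h => hu (by rw [h, map_zero]), rfl⟩

end SuperellipticCurve

namespace SuperellipticCurve

variable {K : Type*} [Field K] {E : SuperellipticCurve K} [IsAlgClosed K]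

/-! ### Divisors of functions -/

omit [IsAlgClosed K] in
theorem finite_hasCoordinates (p : K[X]) (hp : p ≠ 0) :
    {P : E.Point | ∃ a b, P.HasCoordinates a b ∧ p.eval a = 0}.Finite := by
  classical
  have h1 : ∀ a b : K, {P : E.Point | P.HasCoordinates a b}.Finite := fun a b =>
    Set.Subsingleton.finite fun P hP Q hQ => Point.eq_of_hasCoordinates hP hQ
  refine (Set.Finite.biUnion p.roots.toFinset.finite_toSet fun a _ => Set.Finite.biUnion
    (X ^ E.n - C (E.f.eval a) : K[X]).roots.toFinset.finite_toSet fun b _ => h1 a b).subset ?_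
  rintro P ⟨a, b, hP, ha⟩
  simp only [Set.mem_iUnion]
  refine ⟨a, ?_, b, ?_, hP⟩
  · simpa [hp] using ha
  · have := (monic_X_pow_sub_C (E.f.eval a) E.n_pos.ne').ne_zero
    simp [this, hP.equation]

/-- The finite zeros of `u` lie among those of a polynomial in `x` that `u` divides. -/
theorem finite_ord_ne_zero_of_coordinateRing {u : E.CoordinateRing} (hu : u ≠ 0) :
    {P : E.Point | P.ord (algebraMap _ E.FunctionField u) ≠ 0}.Finite := by
  obtain ⟨w, p, hp, e⟩ := E.exists_mul_eq_aeval hu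
  have hw : w ≠ 0 := by
    rintro rfl
    rw [map_zero, mul_zero] at e
    exact E.aeval_x_ne_zero hp e.symm
  have h1 : {P : E.Point | P.IsAtInfinity}.Finite :=
    Set.Subsingleton.finite fun P hP Q hQ => Point.IsAtInfinity.eq hP hQ
  refine (h1.union (finite_hasCoordinates p hp)).subset fun P hP => ?_
  rcases P.isAtInfinity_or_exists_hasCoordinates with hinf | ⟨a, b, hab⟩
  · exact Or.inl hinf
  · refine Or.inr ⟨a, b, hab, ?_⟩
    by_contra ha
    have h2 := (P.val_eq_one_iff (E.aeval_x_ne_zero hp)).1 (hab.val_aeval ha)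
    rw [← e, P.ord_mul (algebraMap_ne_zero hu) (algebraMap_ne_zero hw)] at h2
    have h3 := hab.ord_nonneg hu
    have h4 := hab.ord_nonneg hw
    exact hP (by omega)

theorem finite_ord_ne_zero (h : E.FunctionField) : {P : E.Point | P.ord h ≠ 0}.Finite := by
  obtain ⟨u, w, hw, rfl⟩ := IsFractionRing.div_surjective (A := E.CoordinateRing) h
  have hw0 : w ≠ 0 := nonZeroDivisors.ne_zero hw
  rcases eq_or_ne u 0 with rfl | hu0
  · simp [Point.ord_zero]
  refine ((finite_ord_ne_zero_of_coordinateRing hu0).union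
    (finite_ord_ne_zero_of_coordinateRing hw0)).subset fun P hP => ?_
  rw [Set.mem_ofPred_eq, P.ord_div (algebraMap_ne_zero hu0) (algebraMap_ne_zero hw0)] at hP
  by_contra hcon
  simp only [Set.mem_union, Set.mem_ofPred_eq, not_or, not_not] at hcon
  omega

/-- The divisor of a function. -/
noncomputable def divisor (h : E.FunctionField) : E.Div :=
  Finsupp.ofSupportFinite (fun P => P.ord h) (finite_ord_ne_zero h)

theorem divisor_apply (h : E.FunctionField) (P : E.Point) : divisor h P = P.ord h := rfl

theorem divisor_mul {g h : E.FunctionField} (hg : g ≠ 0) (hh : h ≠ 0) :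
    divisor (g * h) = divisor g + divisor h :=
  Finsupp.ext fun P => P.ord_mul hg hh

theorem divisor_inv (h : E.FunctionField) : divisor h⁻¹ = -divisor h :=
  Finsupp.ext fun P => P.ord_inv h

theorem divisor_const (c : K) : divisor (algebraMap K E.FunctionField c) = 0 :=
  Finsupp.ext fun P => P.ord_const c

theorem mem_princ_iff {D : E.Div} : D ∈ E.Princ ↔ ∃ h : E.FunctionField, h ≠ 0 ∧ D = divisor h :=
  ⟨fun ⟨h, hh, e⟩ => ⟨h, hh, Finsupp.ext e⟩, fun ⟨h, hh, e⟩ => ⟨h, hh, fun _ => e ▸ rfl⟩⟩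

theorem divisor_mem_princ {h : E.FunctionField} (hh : h ≠ 0) : divisor h ∈ E.Princ :=
  mem_princ_iff.2 ⟨h, hh, rfl⟩

omit [IsAlgClosed K] in
theorem Point.IsAtInfinity.not_hasCoordinates {O : E.Point} (hO : O.IsAtInfinity) (a b : K) :
    ¬ O.HasCoordinates a b := fun h => absurd hO (not_lt.2 h.val_x_le_one)

omit [IsAlgClosed K] in
theorem Point.HasCoordinates.eq_zero {P : E.Point} {i : Fin E.d} {b : K}
    (hP : P.HasCoordinates (-E.α i) b) : b = 0 := by
  have h := hP.equation
  rwa [eval_f_eq_zero_iff.2 ⟨i, rfl⟩, pow_eq_zero_iff E.n_pos.ne'] at h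

omit [IsAlgClosed K] in
theorem Point.HasCoordinates.exists_eq_neg {P : E.Point} {a : K}
    (hP : P.HasCoordinates a 0) : ∃ i, a = -E.α i := by
  have h := hP.equation
  rwa [zero_pow E.n_pos.ne', eq_comm, eval_f_eq_zero_iff] at h

theorem divisor_x_sub_of_zero {O P : E.Point} (hO : O.IsAtInfinity) {i : Fin E.d}
    (hP : P.HasCoordinates (-E.α i) 0) :
    divisor (E.x - algebraMap K E.FunctionField (-E.α i)) =
      Finsupp.single P (E.n : ℤ) - Finsupp.single O (E.n : ℤ) := by
  have hPO : P ≠ O := by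
    rintro rfl
    exact hO.not_hasCoordinates _ _ hP
  ext Q
  rw [divisor_apply, Finsupp.sub_apply]
  rcases Q.isAtInfinity_or_exists_hasCoordinates with hQ | ⟨a, b, hQ⟩
  · obtain rfl := hO.eq hQ
    rw [hO.ord_x_sub, Finsupp.single_eq_same, Finsupp.single_eq_of_ne hPO.symm, zero_sub]
  · have hQO : Q ≠ O := by
      rintro rfl
      exact hO.not_hasCoordinates _ _ hQ
    rw [Finsupp.single_eq_of_ne hQO, sub_zero]
    by_cases ha : a = -E.α i
    · subst ha
      obtain rfl := hQ.eq_zero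
      obtain rfl := Point.eq_of_hasCoordinates hP hQ
      rw [hP.ord_x_sub_of_zero, Finsupp.single_eq_same]
    · rw [hQ.ord_x_sub_of_ne ha, Finsupp.single_eq_of_ne]
      rintro rfl
      exact ha (Point.hasCoordinates_unique hQ hP).1

theorem divisor_y {O : E.Point} (hO : O.IsAtInfinity) {P : Fin E.d → E.Point}
    (hP : ∀ i, (P i).HasCoordinates (-E.α i) 0) :
    divisor E.y = ∑ i, (Finsupp.single (P i) (1 : ℤ) - Finsupp.single O (1 : ℤ)) := by
  have hPO : ∀ i, P i ≠ O := fun i h => hO.not_hasCoordinates _ _ (h ▸ hP i)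
  ext Q
  rw [divisor_apply, Finsupp.finsetSum_apply]
  simp_rw [Finsupp.sub_apply]
  rcases Q.isAtInfinity_or_exists_hasCoordinates with hQ | ⟨a, b, hQ⟩
  · obtain rfl := hO.eq hQ
    rw [hO.ord_x_and_ord_y.2, Finset.sum_congr rfl (g := fun _ => (-1 : ℤ)) fun i _ => by
      rw [Finsupp.single_eq_same, Finsupp.single_eq_of_ne (hPO i).symm, zero_sub]]
    simp
  · have hQO : Q ≠ O := by
      rintro rfl
      exact hO.not_hasCoordinates _ _ hQ
    simp_rw [Finsupp.single_eq_of_ne hQO, sub_zero]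
    by_cases hb : b = 0
    · subst hb
      obtain ⟨i, rfl⟩ := hQ.exists_eq_neg
      obtain rfl := Point.eq_of_hasCoordinates (hP i) hQ
      rw [hQ.ord_y, Finset.sum_eq_single i, Finsupp.single_eq_same]
      · intro j _ hj
        refine Finsupp.single_eq_of_ne fun h => hj (E.α_injective ?_)
        exact neg_injective (Point.hasCoordinates_unique (h ▸ hP j) (hP i)).1
      · simp
    · rw [hQ.ord_y_of_ne_zero hb, Finset.sum_eq_zero]
      intro i _
      refine Finsupp.single_eq_of_ne ?_
      rintro rfl
      exact hb (Point.hasCoordinates_unique hQ (hP i)).2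

/-! ### The action on points and the degree of a principal divisor -/

variable {ζ : K} (hζ : IsPrimitiveRoot ζ E.n)

omit [IsAlgClosed K] in
theorem Point.HasCoordinates.iterate_rotate {P : E.Point} {a b : K} (hP : P.HasCoordinates a b)
    (k : ℕ) : ((Point.rotate hζ)^[k] P).HasCoordinates a (ζ ^ k * b) := by
  induction k with
  | zero => simpa using hP
  | succ k ih =>
    rw [Function.iterate_succ_apply', pow_succ', mul_assoc]
    exact ih.rotate hζ

omit [IsAlgClosed K] in
/-- The automorphism permutes the points with given `x`-coordinate transitively. -/
theorem Point.HasCoordinates.exists_eq_iterate_rotate {P Q : E.Point} {a b c : K}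
    (hP : P.HasCoordinates a b) (hb : b ≠ 0) (hQ : Q.HasCoordinates a c) :
    ∃ k < E.n, Q = (Point.rotate hζ)^[k] P := by
  have : NeZero E.n := ⟨E.n_pos.ne'⟩
  obtain ⟨k, hk, e⟩ := hζ.eq_pow_of_pow_eq_one (ξ := c / b) (by
    rw [div_pow, hQ.equation, ← hP.equation, div_self (pow_ne_zero _ hb)])
  refine ⟨k, hk, Point.eq_of_hasCoordinates hQ ?_⟩
  have := hP.iterate_rotate hζ k
  rwa [e, div_mul_cancel₀ _ hb] at this

theorem divisor_x_sub_of_ne_zero {O P : E.Point} (hO : O.IsAtInfinity) {a b : K}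
    (hP : P.HasCoordinates a b) (hb : b ≠ 0) :
    divisor (E.x - algebraMap K E.FunctionField a) =
      ∑ k ∈ Finset.range E.n, Finsupp.single ((Point.rotate hζ)^[k] P) (1 : ℤ) -
        Finsupp.single O (E.n : ℤ) := by
  ext Q
  rw [divisor_apply, Finsupp.sub_apply, Finsupp.finsetSum_apply]
  rcases Q.isAtInfinity_or_exists_hasCoordinates with hQ | ⟨a', c, hQ⟩
  · obtain rfl := hO.eq hQ
    rw [hO.ord_x_sub, Finsupp.single_eq_same, Finset.sum_eq_zero, zero_sub]
    intro k _
    refine Finsupp.single_eq_of_ne fun h => ?_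
    exact hO.not_hasCoordinates _ _ (h ▸ hP.iterate_rotate hζ k)
  · have hQO : Q ≠ O := by
      rintro rfl
      exact hO.not_hasCoordinates _ _ hQ
    rw [Finsupp.single_eq_of_ne hQO, sub_zero]
    by_cases ha : a' = a
    · subst ha
      obtain ⟨k, hk, rfl⟩ := hP.exists_eq_iterate_rotate hζ hb hQ
      have hk' := hP.iterate_rotate hζ k
      rw [hk'.ord_x_sub (mul_ne_zero (pow_ne_zero _ (hζ.ne_zero E.n_pos.ne')) hb),
        Finset.sum_eq_single_of_mem k (Finset.mem_range.2 hk), Finsupp.single_eq_same]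
      intro j hj hjk
      refine Finsupp.single_eq_of_ne fun h => hjk ?_
      have h1 := (Point.hasCoordinates_unique (h ▸ hP.iterate_rotate hζ j) hk').2
      exact hζ.pow_inj (Finset.mem_range.1 hj) hk (mul_right_cancel₀ hb h1)
    · rw [hQ.ord_x_sub_of_ne ha, Finset.sum_eq_zero]
      intro k _
      refine Finsupp.single_eq_of_ne ?_
      rintro rfl
      exact ha (Point.hasCoordinates_unique hQ (hP.iterate_rotate hζ k)).1

include hζ in
theorem degree_divisor_x_sub (a : K) :
    E.degree (divisor (E.x - algebraMap K E.FunctionField a)) = 0 := by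
  obtain ⟨O, hO⟩ := E.exists_isAtInfinity
  obtain ⟨P, hP⟩ := E.exists_val_x_sub_lt_one a
  obtain ⟨b, hb⟩ := Point.exists_hasCoordinates_of_val_lt_one hP
  by_cases hb0 : b = 0
  · subst hb0
    obtain ⟨i, rfl⟩ := hb.exists_eq_neg
    rw [divisor_x_sub_of_zero hO hb, map_sub, degree_single, degree_single, sub_self]
  · rw [divisor_x_sub_of_ne_zero hζ hO hb hb0, map_sub, map_sum, degree_single]
    simp [degree_single]

include hζ in
theorem degree_divisor_aeval {p : K[X]} (hp : p ≠ 0) :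
    E.degree (divisor (aeval E.x p)) = 0 := by
  have key : ∀ s : Multiset K,
      E.degree (divisor (aeval E.x (s.map fun a => X - C a).prod)) = 0 := by
    intro s
    induction s using Multiset.induction_on with
    | empty =>
      rw [Multiset.map_zero, Multiset.prod_zero, map_one,
        ← map_one (algebraMap K E.FunctionField), divisor_const, map_zero]
    | cons a s ih =>
      rw [Multiset.map_cons, Multiset.prod_cons, map_mul, divisor_mul
        (E.aeval_x_ne_zero (X_sub_C_ne_zero a)) (E.aeval_x_ne_zero
          (monic_multisetProd_X_sub_C s).ne_zero), map_add, ih, add_zero, map_sub, aeval_X, aeval_C,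
        degree_divisor_x_sub hζ]
  conv_lhs => rw [(IsAlgClosed.splits p).eq_prod_roots]
  have h1 : algebraMap K E.FunctionField p.leadingCoeff ≠ 0 :=
    (_root_.map_ne_zero _).2 (leadingCoeff_ne_zero.2 hp)
  rw [map_mul, aeval_C, divisor_mul h1 (E.aeval_x_ne_zero (monic_multisetProd_X_sub_C _).ne_zero),
    map_add, divisor_const, map_zero, zero_add, key]

omit [IsAlgClosed K] in
theorem rotateDiv_apply_rotate (D : E.Div) (P : E.Point) :
    rotateDiv hζ D (P.rotate hζ) = D P :=
  Finsupp.mapDomain_apply (Point.rotate_injective hζ) D P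

theorem rotateDiv_divisor_pullback (h : E.FunctionField) :
    rotateDiv hζ (divisor (E.pullback hζ h)) = divisor h := by
  ext P
  obtain ⟨Q, rfl⟩ := Point.rotate_surjective hζ P
  rw [rotateDiv_apply_rotate]
  rfl

theorem degree_divisor_pullbackPow (k : ℕ) (h : E.FunctionField) :
    E.degree (divisor (pullbackPow hζ k h)) = E.degree (divisor h) := by
  induction k with
  | zero => rfl
  | succ k ih =>
    rw [← ih, pullbackPow_succ, ← degree_rotateDiv hζ, rotateDiv_divisor_pullback]

theorem divisor_prod {ι : Type*} (s : Finset ι) (g : ι → E.FunctionField)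
    (hg : ∀ i ∈ s, g i ≠ 0) : divisor (∏ i ∈ s, g i) = ∑ i ∈ s, divisor (g i) := by
  ext P
  rw [Finsupp.finsetSum_apply]
  exact P.ord_prod s g hg

include hζ in
/-- Principal divisors have degree zero. -/
theorem degree_divisor {h : E.FunctionField} (hh : h ≠ 0) : E.degree (divisor h) = 0 := by
  -- The automorphism preserves degrees, and the norm is a rational function of `x`, whose divisor
  -- has degree zero.
  have h1 : E.degree (divisor (norm hζ h)) = E.n * E.degree (divisor h) := by
    rw [norm, divisor_prod _ _ fun k _ => pullbackPow_ne_zero hζ k hh, map_sum]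
    simp_rw [degree_divisor_pullbackPow]
    simp
  obtain ⟨p, q, hq, e⟩ := exists_eq_div_of_pullback_eq hζ (pullback_norm hζ hh)
  have hp : p ≠ 0 := by
    rintro rfl
    rw [map_zero, zero_div] at e
    exact norm_ne_zero hζ hh e
  rw [e, div_eq_mul_inv, divisor_mul (E.aeval_x_ne_zero hp) (inv_ne_zero (E.aeval_x_ne_zero hq)),
    divisor_inv, map_add, map_neg, degree_divisor_aeval hζ hp, degree_divisor_aeval hζ hq] at h1
  simpa [E.n_pos.ne'] using h1.symm

/-! ### Divisors invariant under the automorphism -/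

omit [IsAlgClosed K] in
theorem iterate_rotate_n (P : E.Point) : (Point.rotate hζ)^[E.n] P = P := by
  ext h
  rw [← Point.val_pullbackPow, pullbackPow_n]

/-- A divisor `D` with `D - ζ D` principal is linearly equivalent to an invariant divisor. -/
theorem exists_invariant_sub_divisor {D : E.Div} (hD : D - rotateDiv hζ D ∈ E.Princ) :
    ∃ g : E.FunctionField, g ≠ 0 ∧
      ∀ P : E.Point, (D - divisor g) (P.rotate hζ) = (D - divisor g) P := by
  obtain ⟨h, hh, e⟩ := mem_princ_iff.1 hD
  have hord : ∀ P : E.Point, P.ord (E.pullback hζ h) = D (P.rotate hζ) - D P := by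
    intro P
    have := DFunLike.congr_fun e (P.rotate hζ)
    rw [Finsupp.sub_apply, rotateDiv_apply_rotate, divisor_apply, Point.ord_rotate] at this
    exact this.symm
  set u := E.pullback hζ h with hu
  have hu0 : u ≠ 0 := (_root_.map_ne_zero _).2 hh
  -- By `hord` the order of the norm of `u` at `P` is a telescoping sum around the orbit of `P`,
  -- hence zero.
  obtain ⟨c, hc, hN⟩ := exists_eq_const_of_ord_eq_zero hζ (norm_ne_zero hζ hu0) fun P => by
    rw [norm, P.ord_prod _ _ fun k _ => pullbackPow_ne_zero hζ k hu0]
    simp_rw [Point.ord_pullbackPow, hord, ← Function.iterate_succ_apply' (Point.rotate hζ)]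
    rw [Finset.sum_range_sub fun k => D ((Point.rotate hζ)^[k] P), iterate_rotate_n]
    simp
  obtain ⟨r, hr⟩ := IsAlgClosed.exists_pow_nat_eq c E.n_pos
  have hr0 : r ≠ 0 := by
    rintro rfl
    exact hc (by rw [← hr, zero_pow E.n_pos.ne'])
  have hr1 : algebraMap K E.FunctionField r ≠ 0 := (_root_.map_ne_zero _).2 hr0
  -- The `n`th root `r` of the constant `c` gives `r / u` norm `1`. The resulting `g` has the same
  -- jump from `P` to `ζ P` as `D`, namely the order of `u` at `P`.
  obtain ⟨g, hg, eg⟩ := exists_mul_pullback_eq hζ (h := algebraMap K _ r * u⁻¹) (by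
    have h1 : norm hζ (algebraMap K _ r * u⁻¹) * norm hζ u = norm hζ (algebraMap K _ r) := by
      rw [← norm_mul, inv_mul_cancel_right₀ hu0]
    rw [norm_const, hr, ← hN] at h1
    exact mul_left_eq_self₀.1 h1 |>.resolve_right (norm_ne_zero hζ hu0))
  refine ⟨g, hg, fun P => ?_⟩
  have h2 := congrArg P.ord eg
  rw [P.ord_mul (mul_ne_zero hr1 (inv_ne_zero hu0)) ((_root_.map_ne_zero _).2 hg),
    P.ord_mul hr1 (inv_ne_zero hu0), P.ord_const, P.ord_inv, hord, ← Point.ord_rotate] at h2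
  rw [Finsupp.sub_apply, Finsupp.sub_apply, divisor_apply, divisor_apply]
  omega

/-- A free orbit is a whole fibre of `x`, so up to a multiple of `∞` it is the divisor of some `x -
a`. Removing these leaves only the fixed points, and degree zero determines the coefficient at `∞`.
-/
theorem exists_sum_sub_mem_princ_of_invariant {O : E.Point} (hO : O.IsAtInfinity)
    {P : Fin E.d → E.Point} (hP : ∀ i, (P i).HasCoordinates (-E.α i) 0) {D : E.Div}
    (hdeg : E.degree D = 0) (hD : ∀ Q : E.Point, D (Q.rotate hζ) = D Q) :
    ∃ a : Fin E.d → ℤ,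
      D - ∑ i, a i • (Finsupp.single (P i) (1 : ℤ) - Finsupp.single O (1 : ℤ)) ∈ E.Princ := by
  classical
  have hiter : ∀ (k : ℕ) (Q : E.Point), D ((Point.rotate hζ)^[k] Q) = D Q := by
    intro k Q
    induction k with
    | zero => rfl
    | succ k ih => rw [Function.iterate_succ_apply', hD, ih]
  have hfin : {a : K | ∃ Q ∈ D.support, ∃ b, Q.HasCoordinates a b}.Finite := by
    have h1 : ∀ Q : E.Point, {a : K | ∃ b, Q.HasCoordinates a b}.Finite := fun Q =>
      Set.Subsingleton.finite fun a ⟨_, ha⟩ a' ⟨_, ha'⟩ => (Point.hasCoordinates_unique ha ha').1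
    refine (Set.Finite.biUnion D.support.finite_toSet fun Q _ => h1 Q).subset ?_
    rintro a ⟨Q, hQ, hb⟩
    simp only [Set.mem_iUnion]
    exact ⟨Q, hQ, hb⟩
  let S := hfin.toFinset
  -- `D` is constant on each fibre, so any point `R a` above `a` gives the exponent. The factors
  -- with `a = -α_i` affect only the coefficients at `P_i` and `∞`, which are left free.
  choose R hR using E.exists_val_x_sub_lt_one
  let g : E.FunctionField := ∏ a ∈ S, (E.x - algebraMap K _ a) ^ D (R a)
  have hg0 : ∀ a ∈ S, (E.x - algebraMap K E.FunctionField a) ^ D (R a) ≠ 0 := fun a _ =>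
    zpow_ne_zero _ (E.x_sub_ne_zero a)
  have hg : g ≠ 0 := Finset.prod_ne_zero_iff.2 hg0
  let D' := D - divisor g
  have hD' : ∀ (Q : E.Point) (a b : K), Q.HasCoordinates a b → b ≠ 0 → D' Q = 0 := by
    intro Q a b hQ hb
    have h1 : Q.ord g = ∑ c ∈ S, D (R c) * Q.ord (E.x - algebraMap K _ c) := by
      rw [Q.ord_prod _ _ hg0]
      simp_rw [Q.ord_zpow]
    obtain ⟨c, hc⟩ := Point.exists_hasCoordinates_of_val_lt_one (hR a)
    obtain ⟨k, -, hk⟩ := hQ.exists_eq_iterate_rotate hζ hb hc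
    have hDR : D (R a) = D Q := by rw [hk, hiter]
    rw [Finset.sum_eq_single a (fun c _ hc => by rw [hQ.ord_x_sub_of_ne hc.symm, mul_zero])
      (fun ha => by
        have : Q ∉ D.support := fun hs => ha (hfin.mem_toFinset.2 ⟨Q, hs, b, hQ⟩)
        rw [hDR, Finsupp.notMem_support_iff.1 this, zero_mul]),
      hQ.ord_x_sub hb, mul_one, hDR] at h1
    rw [Finsupp.sub_apply, divisor_apply, h1, sub_self]
  have hdeg' : E.degree D' = 0 := by rw [map_sub, hdeg, degree_divisor hζ hg, sub_self]
  have hsum : D' = ∑ i, Finsupp.single (P i) (D' (P i)) + Finsupp.single O (D' O) := by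
    ext Q
    rw [Finsupp.add_apply, Finsupp.finsetSum_apply]
    rcases Q.isAtInfinity_or_exists_hasCoordinates with hQ | ⟨a, b, hQ⟩
    · obtain rfl := hO.eq hQ
      rw [Finsupp.single_eq_same, Finset.sum_eq_zero, zero_add]
      intro i _
      exact Finsupp.single_eq_of_ne fun h => hO.not_hasCoordinates _ _ (h ▸ hP i)
    · have hQO : Q ≠ O := by
        rintro rfl
        exact hO.not_hasCoordinates _ _ hQ
      rw [Finsupp.single_eq_of_ne hQO, add_zero]
      by_cases hb : b = 0
      · subst hb
        obtain ⟨i, rfl⟩ := hQ.exists_eq_neg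
        obtain rfl := Point.eq_of_hasCoordinates (hP i) hQ
        rw [Finset.sum_eq_single i, Finsupp.single_eq_same]
        · intro j _ hj
          refine Finsupp.single_eq_of_ne fun h => hj (E.α_injective ?_)
          exact neg_injective (Point.hasCoordinates_unique (h ▸ hP j) (hP i)).1
        · simp
      · rw [hD' Q a b hQ hb, Finset.sum_eq_zero]
        intro i _
        refine Finsupp.single_eq_of_ne ?_
        rintro rfl
        exact hb (Point.hasCoordinates_unique hQ (hP i)).2
  have hO' : ∑ i, D' (P i) + D' O = 0 := by
    rw [hsum, map_add, map_sum, degree_single] at hdeg'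
    simpa only [degree_single] using hdeg'
  refine ⟨fun i => D' (P i), ?_⟩
  have e : ∑ i, D' (P i) • (Finsupp.single (P i) (1 : ℤ) - Finsupp.single O (1 : ℤ)) = D' := by
    conv_rhs => rw [hsum]
    simp_rw [smul_sub, Finsupp.smul_single, smul_eq_mul, mul_one]
    rw [Finset.sum_sub_distrib, ← Finsupp.single_finsetSum, sub_eq_add_neg, ← Finsupp.single_neg,
      show -∑ i, D' (P i) = D' O by omega]
  rw [e, sub_sub_cancel]
  exact divisor_mem_princ hg

theorem exists_sum_sub_mem_princ {O : E.Point} (hO : O.IsAtInfinity) {P : Fin E.d → E.Point}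
    (hP : ∀ i, (P i).HasCoordinates (-E.α i) 0) {D : E.Div} (hdeg : E.degree D = 0)
    (hD : D - rotateDiv hζ D ∈ E.Princ) :
    ∃ a : Fin E.d → ℤ,
      D - ∑ i, a i • (Finsupp.single (P i) (1 : ℤ) - Finsupp.single O (1 : ℤ)) ∈ E.Princ := by
  obtain ⟨g, hg, hinv⟩ := exists_invariant_sub_divisor hζ hD
  obtain ⟨a, ha⟩ := exists_sum_sub_mem_princ_of_invariant hζ hO hP
    (by rw [map_sub, hdeg, degree_divisor hζ hg, sub_self]) hinv
  refine ⟨a, ?_⟩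
  have := E.Princ.add_mem ha (divisor_mem_princ hg)
  rwa [sub_right_comm, sub_add_cancel] at this

/-! ### Relations between the fixed points -/

omit [IsAlgClosed K] in
theorem Point.HasCoordinates.rotate_eq {P : E.Point} {a : K} (hP : P.HasCoordinates a 0) :
    P.rotate hζ = P :=
  Point.eq_of_hasCoordinates (by simpa using hP.rotate hζ) hP

theorem Point.IsAtInfinity.rotate_eq {O : E.Point} (hO : O.IsAtInfinity) : O.rotate hζ = O := by
  refine Point.IsAtInfinity.eq ?_ hO
  change 1 < O.val (E.pullback hζ E.x)
  rw [pullback_x]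
  exact hO

/-- Each linear factor `x - a` has order `n` or `0` at `P_i`. -/
theorem Point.HasCoordinates.dvd_ord_aeval {P : E.Point} {i : Fin E.d}
    (hP : P.HasCoordinates (-E.α i) 0) {p : K[X]} (hp : p ≠ 0) :
    (E.n : ℤ) ∣ P.ord (aeval E.x p) := by
  have key : ∀ s : Multiset K,
      (E.n : ℤ) ∣ P.ord (aeval E.x (s.map fun a => X - C a).prod) := by
    intro s
    induction s using Multiset.induction_on with
    | empty =>
      rw [Multiset.map_zero, Multiset.prod_zero, map_one, P.ord_one]
      exact dvd_zero _
    | cons a s ih =>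
      rw [Multiset.map_cons, Multiset.prod_cons, map_mul, P.ord_mul
        (E.aeval_x_ne_zero (X_sub_C_ne_zero a)) (E.aeval_x_ne_zero
          (monic_multisetProd_X_sub_C s).ne_zero), map_sub, aeval_X, aeval_C]
      refine dvd_add ?_ ih
      by_cases ha : -E.α i = a
      · rw [← ha, hP.ord_x_sub_of_zero]
      · rw [hP.ord_x_sub_of_ne ha]
        exact dvd_zero _
  rw [(IsAlgClosed.splits p).eq_prod_roots]
  have h1 : algebraMap K E.FunctionField p.leadingCoeff ≠ 0 :=
    (_root_.map_ne_zero _).2 (leadingCoeff_ne_zero.2 hp)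
  rw [map_mul, aeval_C, P.ord_mul h1 (E.aeval_x_ne_zero (monic_multisetProd_X_sub_C _).ne_zero),
    P.ord_const, zero_add]
  exact key _

omit [IsAlgClosed K] in
theorem Point.HasCoordinates.sum_apply {O : E.Point} (hO : O.IsAtInfinity) {P : Fin E.d → E.Point}
    (hP : ∀ i, (P i).HasCoordinates (-E.α i) 0) (a : Fin E.d → ℤ) (i : Fin E.d) :
    (∑ j, a j • (Finsupp.single (P j) (1 : ℤ) - Finsupp.single O (1 : ℤ))) (P i) = a i := by
  rw [Finsupp.finsetSum_apply, Finset.sum_eq_single i]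
  · rw [Finsupp.smul_apply, Finsupp.sub_apply, Finsupp.single_eq_same,
      Finsupp.single_eq_of_ne fun h => hO.not_hasCoordinates _ _ (h ▸ hP i)]
    simp
  · intro j _ hj
    have h1 : P i ≠ P j := fun h => hj (E.α_injective
      (neg_injective (Point.hasCoordinates_unique (h ▸ hP j) (hP i)).1))
    rw [Finsupp.smul_apply, Finsupp.sub_apply, Finsupp.single_eq_of_ne h1,
      Finsupp.single_eq_of_ne fun h => hO.not_hasCoordinates _ _ (h ▸ hP i)]
    simp
  · simp

include hζ in
theorem exists_forall_dvd_sub_of_mem_princ {O : E.Point} (hO : O.IsAtInfinity)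
    {P : Fin E.d → E.Point} (hP : ∀ i, (P i).HasCoordinates (-E.α i) 0) {a : Fin E.d → ℤ}
    (h : ∑ i, a i • (Finsupp.single (P i) (1 : ℤ) - Finsupp.single O (1 : ℤ)) ∈ E.Princ) :
    ∃ j : ℤ, ∀ i, (E.n : ℤ) ∣ a i - j := by
  set D : E.Div := ∑ i, a i • (Finsupp.single (P i) (1 : ℤ) - Finsupp.single O (1 : ℤ)) with hDdef
  obtain ⟨h, hh, e⟩ := mem_princ_iff.1 h
  have hrot : rotateDiv hζ D = D := by
    rw [hDdef, map_sum]
    refine Finset.sum_congr rfl fun i _ => ?_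
    rw [map_zsmul, map_sub, rotateDiv_single, rotateDiv_single, (hP i).rotate_eq, hO.rotate_eq]
  have hσ : E.pullback hζ h ≠ 0 := (_root_.map_ne_zero _).2 hh
  -- The divisor of `h` is invariant, so `h ∘ ζ` and `h` differ by a constant `c`. Since `ζ ^ n`
  -- acts trivially, `c ^ n = 1`.
  obtain ⟨c, hc, ec⟩ := exists_eq_const_of_ord_eq_zero hζ (div_ne_zero hσ hh) fun Q => by
    rw [Q.ord_div hσ hh, ← Point.ord_rotate, ← divisor_apply, ← divisor_apply, ← e]
    conv_lhs => rw [← hrot]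
    rw [rotateDiv_apply_rotate, hrot, sub_self]
  rw [div_eq_iff hh] at ec
  have hpow : ∀ k, pullbackPow hζ k h = algebraMap K _ (c ^ k) * h := by
    intro k
    induction k with
    | zero => simp [pullbackPow_zero]
    | succ k ih =>
      rw [pullbackPow_succ, ih, map_mul, pullback_const, ec, ← mul_assoc, ← map_mul, ← pow_succ]
  have hcn : c ^ E.n = 1 := by
    have h1 := hpow E.n
    rw [pullbackPow_n] at h1
    have h2 : algebraMap K E.FunctionField (c ^ E.n) = algebraMap K E.FunctionField 1 := by
      rw [map_one]
      exact mul_right_cancel₀ hh (by rw [← h1, one_mul])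
    exact (algebraMap K E.FunctionField).injective h2
  have : NeZero E.n := ⟨E.n_pos.ne'⟩
  obtain ⟨j, -, rfl⟩ := hζ.eq_pow_of_pow_eq_one hcn
  have hyj : E.y ^ j ≠ 0 := pow_ne_zero _ E.y_ne_zero
  -- Both `h` and `y ^ j` have eigenvalue `ζ ^ j`, so their quotient is invariant.
  obtain ⟨p, q, hq, er⟩ := exists_eq_div_of_pullback_eq hζ (h := h / E.y ^ j) (by
    rw [map_div₀, map_pow, pullback_y, ec, mul_pow, ← map_pow]
    exact mul_div_mul_left _ _ ((_root_.map_ne_zero _).2 hc))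
  have hp : p ≠ 0 := by
    rintro rfl
    rw [map_zero, zero_div] at er
    exact div_ne_zero hh hyj er
  refine ⟨j, fun i => ?_⟩
  have h1 := congrArg (P i).ord er
  rw [Point.ord_div _ hh hyj, Point.ord_div _ (E.aeval_x_ne_zero hp) (E.aeval_x_ne_zero hq),
    Point.ord_pow, (hP i).ord_y, mul_one, ← divisor_apply, ← e, hDdef,
    Point.HasCoordinates.sum_apply hO hP] at h1
  rw [h1]
  exact dvd_sub ((hP i).dvd_ord_aeval hp) ((hP i).dvd_ord_aeval hq)

end SuperellipticCurve

namespace SuperellipticCurve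

variable {K : Type*} [Field K] {E : SuperellipticCurve K} {ζ : K} (hζ : IsPrimitiveRoot ζ E.n)

/-! ### Classes in the jacobian -/

theorem mk_eq_zero_iff {D : E.DivZero} :
    (QuotientAddGroup.mk D : E.Jacobian) = 0 ↔ (D : E.Div) ∈ E.Princ := by
  rw [QuotientAddGroup.eq_zero_iff, AddSubgroup.mem_addSubgroupOf]

theorem mk_mem_oneSubZetaTorsion_iff {D : E.DivZero} :
    (QuotientAddGroup.mk D : E.Jacobian) ∈ oneSubZetaTorsion hζ ↔
      (D : E.Div) - rotateDiv hζ D ∈ E.Princ :=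
  mk_eq_zero_iff (D := D - rotateDivZero hζ D)

theorem sum_zsmul_divClass {ι : Type*} (s : Finset ι) (P : ι → E.Point) (O : E.Point)
    (a : ι → ℤ) : ∑ i ∈ s, a i • E.divClass (P i) O =
      (QuotientAddGroup.mk (∑ i ∈ s, a i • E.subDiv (P i) O) : E.Jacobian) :=
  (map_sum (QuotientAddGroup.mk' _) (fun i => a i • E.subDiv (P i) O) s).symm

theorem coe_sum_zsmul_subDiv {ι : Type*} (s : Finset ι) (P : ι → E.Point) (O : E.Point)
    (a : ι → ℤ) : ((∑ i ∈ s, a i • E.subDiv (P i) O : E.DivZero) : E.Div) =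
      ∑ i ∈ s, a i • (Finsupp.single (P i) (1 : ℤ) - Finsupp.single O (1 : ℤ)) :=
  map_sum E.DivZero.subtype (fun i => a i • E.subDiv (P i) O) s

theorem sum_zsmul_divClass_eq_zero_iff {ι : Type*} {s : Finset ι} {P : ι → E.Point} {O : E.Point}
    {a : ι → ℤ} : ∑ i ∈ s, a i • E.divClass (P i) O = 0 ↔
      ∑ i ∈ s, a i • (Finsupp.single (P i) (1 : ℤ) - Finsupp.single O (1 : ℤ)) ∈ E.Princ := by
  rw [sum_zsmul_divClass, mk_eq_zero_iff, coe_sum_zsmul_subDiv]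

variable [IsAlgClosed K] {O : E.Point} {P : Fin E.d → E.Point}

theorem divClass_mem_oneSubZetaTorsion (hO : O.IsAtInfinity)
    (hP : ∀ i, (P i).HasCoordinates (-E.α i) 0) (i : Fin E.d) :
    E.divClass (P i) O ∈ oneSubZetaTorsion hζ := by
  refine (mk_mem_oneSubZetaTorsion_iff hζ).2 ?_
  have : rotateDiv hζ (E.subDiv (P i) O : E.Div) = E.subDiv (P i) O := by
    rw [subDiv, map_sub, rotateDiv_single, rotateDiv_single, (hP i).rotate_eq, hO.rotate_eq]
  rw [this, sub_self]
  exact E.Princ.zero_mem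

theorem nsmul_divClass (hO : O.IsAtInfinity) (hP : ∀ i, (P i).HasCoordinates (-E.α i) 0)
    (i : Fin E.d) : E.n • E.divClass (P i) O = 0 := by
  refine mk_eq_zero_iff (D := E.n • E.subDiv (P i) O) |>.2 ?_
  have : ((E.n • E.subDiv (P i) O : E.DivZero) : E.Div) =
      divisor (E.x - algebraMap K E.FunctionField (-E.α i)) := by
    rw [divisor_x_sub_of_zero hO (hP i), AddSubgroup.coe_nsmul, subDiv, smul_sub,
      Finsupp.smul_single, Finsupp.smul_single, nsmul_one]
  rw [this]
  exact divisor_mem_princ (E.x_sub_ne_zero _)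

theorem sum_divClass (hO : O.IsAtInfinity) (hP : ∀ i, (P i).HasCoordinates (-E.α i) 0) :
    ∑ i, E.divClass (P i) O = 0 := by
  have h := sum_zsmul_divClass_eq_zero_iff (s := Finset.univ) (P := P) (O := O) (a := fun _ => 1)
  simp only [one_smul] at h
  rw [h, ← divisor_y hO hP]
  exact divisor_mem_princ E.y_ne_zero

theorem exists_eq_sum_zsmul_divClass (hO : O.IsAtInfinity)
    (hP : ∀ i, (P i).HasCoordinates (-E.α i) 0) {z : E.Jacobian}
    (hz : z ∈ oneSubZetaTorsion hζ) : ∃ a : Fin E.d → ℤ, z = ∑ i, a i • E.divClass (P i) O := by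
  obtain ⟨D, rfl⟩ := QuotientAddGroup.mk_surjective z
  obtain ⟨a, ha⟩ := exists_sum_sub_mem_princ hζ hO hP D.2 ((mk_mem_oneSubZetaTorsion_iff hζ).1 hz)
  refine ⟨a, ?_⟩
  rw [sum_zsmul_divClass, ← sub_eq_zero]
  refine mk_eq_zero_iff (D := D - ∑ i, a i • E.subDiv (P i) O) |>.2 ?_
  rwa [AddSubgroup.coe_sub, coe_sum_zsmul_subDiv]

theorem closure_range_divClass (hO : O.IsAtInfinity)
    (hP : ∀ i, (P i).HasCoordinates (-E.α i) 0) :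
    AddSubgroup.closure (Set.range fun i => E.divClass (P i) O) = oneSubZetaTorsion hζ := by
  refine le_antisymm ?_ fun z hz => ?_
  · rw [AddSubgroup.closure_le]
    rintro _ ⟨i, rfl⟩
    exact divClass_mem_oneSubZetaTorsion hζ hO hP i
  · obtain ⟨a, rfl⟩ := exists_eq_sum_zsmul_divClass hζ hO hP hz
    exact sum_mem fun i _ => zsmul_mem (AddSubgroup.subset_closure (Set.mem_range_self i)) _

theorem nsmul_eq_zero_of_mem_oneSubZetaTorsion (hO : O.IsAtInfinity)
    (hP : ∀ i, (P i).HasCoordinates (-E.α i) 0) (z : oneSubZetaTorsion hζ) : E.n • z = 0 := by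
  obtain ⟨a, ha⟩ := exists_eq_sum_zsmul_divClass hζ hO hP z.2
  refine Subtype.ext ?_
  rw [AddSubgroup.coe_nsmul, ha, Finset.smul_sum]
  refine Finset.sum_eq_zero fun i _ => ?_
  rw [smul_comm, nsmul_divClass hO hP, smul_zero]

include hζ in
theorem exists_forall_eq_of_sum_zsmul_eq_zero (hO : O.IsAtInfinity)
    (hP : ∀ i, (P i).HasCoordinates (-E.α i) 0) {a : Fin E.d → ℤ}
    (h : ∑ i, a i • E.divClass (P i) O = 0) : ∃ j : ℤ, ∀ i, (a i : ZMod E.n) = j := by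
  obtain ⟨j, hj⟩ := exists_forall_dvd_sub_of_mem_princ hζ hO hP
    (sum_zsmul_divClass_eq_zero_iff.1 h)
  refine ⟨j, fun i => ?_⟩
  rw [← sub_eq_zero, ← Int.cast_sub]
  exact (ZMod.intCast_zmod_eq_zero_iff_dvd _ _).2 (hj i)

end SuperellipticCurve

/-! ### The split exact sequence -/

/-- A right exact sequence of modules whose first map has a retraction splits. -/
theorem Function.Exact.exists_splitting {R A B C : Type*} [Ring R] [AddCommGroup A]
    [AddCommGroup B] [AddCommGroup C] [Module R A] [Module R B] [Module R C] {f : A →ₗ[R] B}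
    {g : B →ₗ[R] C} (h : Function.Exact f g) (hg : Function.Surjective g) {r : B →ₗ[R] A}
    (hr : r ∘ₗ f = LinearMap.id) : ∃ t : C →ₗ[R] B,
      g ∘ₗ t = LinearMap.id ∧ f ∘ₗ r + t ∘ₗ g = LinearMap.id := by
  -- The projection `id - f ∘ r` kills the range of `f`, which is the kernel of `g`, and so descends
  -- to `C`.
  let t : C →ₗ[R] B := (LinearMap.ker g).liftQ (LinearMap.id - f ∘ₗ r) (by
    intro b hb
    obtain ⟨a, rfl⟩ := (h b).1 hb
    have : r (f a) = a := LinearMap.congr_fun hr a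
    simp [this]) ∘ₗ (g.quotKerEquivOfSurjective hg).symm.toLinearMap
  have ht : ∀ b, t (g b) = b - f (r b) := by
    intro b
    have : (g.quotKerEquivOfSurjective hg).symm (g b) = (LinearMap.ker g).mkQ b := by
      rw [LinearEquiv.symm_apply_eq]
      rfl
    simp only [t, LinearMap.comp_apply, LinearEquiv.coe_coe, this, Submodule.mkQ_apply,
      Submodule.liftQ_apply]
    rfl
  refine ⟨t, ?_, ?_⟩
  · ext c
    obtain ⟨b, rfl⟩ := hg c
    have : g (f (r b)) = 0 := (h _).2 ⟨_, rfl⟩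
    simp [ht, this]
  · ext b
    simp [ht]

theorem mainTheorem3 {K : Type*} [Field K] [IsAlgClosed K] (E : SuperellipticCurve K)
    {ζ : K} (hζ : IsPrimitiveRoot ζ E.n) :
    -- the points `∞` and `P_i = (-α_i, 0)` of the smooth projective model are well defined
    (∃! O : E.Point, O.IsAtInfinity) ∧
    (∀ i, ∃! P : E.Point, P.HasCoordinates (-E.α i) 0) ∧
    ∀ (O : E.Point) (P : Fin E.d → E.Point), O.IsAtInfinity →
      (∀ i, (P i).HasCoordinates (-E.α i) 0) →
      ∃ (_ : Module (ZMod E.n) (SuperellipticCurve.oneSubZetaTorsion hζ))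
        (Δ : ZMod E.n →ₗ[ZMod E.n] (Fin E.d → ZMod E.n))
        (s : (Fin E.d → ZMod E.n) →ₗ[ZMod E.n] SuperellipticCurve.oneSubZetaTorsion hζ),
        -- the two maps
        Δ 1 = (fun _ => 1) ∧
        (∀ a : Fin E.d → ℤ,
          (s (fun i => (a i : ZMod E.n)) : E.Jacobian) = ∑ i, a i • E.divClass (P i) O) ∧
        -- exactness
        Function.Injective Δ ∧ Function.Exact Δ s ∧ Function.Surjective s ∧
        -- the sequence splits
        (∃ (r : (Fin E.d → ZMod E.n) →ₗ[ZMod E.n] ZMod E.n)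
          (t : SuperellipticCurve.oneSubZetaTorsion hζ →ₗ[ZMod E.n] (Fin E.d → ZMod E.n)),
          r ∘ₗ Δ = LinearMap.id ∧ s ∘ₗ t = LinearMap.id ∧
            Δ ∘ₗ r + t ∘ₗ s = LinearMap.id) ∧
        -- the classes `[P_i - ∞]` generate, and `∑ [P_i - ∞] = 0` is the only relation
        LinearMap.ker s = Submodule.span (ZMod E.n) {fun _ => 1} ∧
        AddSubgroup.closure (Set.range fun i => E.divClass (P i) O) =
          SuperellipticCurve.oneSubZetaTorsion hζ ∧
        ∑ i, E.divClass (P i) O = 0 := by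
  refine ⟨E.existsUnique_isAtInfinity, SuperellipticCurve.existsUnique_hasCoordinates,
    fun O P hO hP => ?_⟩
  -- The instance may stay opaque: in any such module structure the class of an integer acts as that
  -- integer.
  obtain ⟨inst⟩ : Nonempty (Module (ZMod E.n) (SuperellipticCurve.oneSubZetaTorsion hζ)) :=
    ⟨AddCommGroup.zmodModule
      (SuperellipticCurve.nsmul_eq_zero_of_mem_oneSubZetaTorsion hζ hO hP)⟩
  let Δ : ZMod E.n →ₗ[ZMod E.n] (Fin E.d → ZMod E.n) :=
    LinearMap.toSpanSingleton (ZMod E.n) _ fun _ => 1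
  let s : (Fin E.d → ZMod E.n) →ₗ[ZMod E.n] SuperellipticCurve.oneSubZetaTorsion hζ :=
    Fintype.linearCombination (ZMod E.n) fun i =>
      ⟨E.divClass (P i) O, SuperellipticCurve.divClass_mem_oneSubZetaTorsion hζ hO hP i⟩
  -- Any index would do: the projection to this coordinate is the retraction of `Δ`.
  let i₀ : Fin E.d := ⟨0, by have := E.two_le_d; omega⟩
  have hΔ : ∀ z i, Δ z i = z := fun z i => mul_one z
  have hs : ∀ a : Fin E.d → ℤ,
      (s (fun i => (a i : ZMod E.n)) : E.Jacobian) = ∑ i, a i • E.divClass (P i) O := by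
    intro a
    simp only [s, Fintype.linearCombination_apply, Int.cast_smul_eq_zsmul]
    rw [AddSubgroup.val_finsetSum]
    rfl
  have hlift : ∀ b : Fin E.d → ZMod E.n, ∃ a : Fin E.d → ℤ, b = fun i => (a i : ZMod E.n) :=
    fun b => ⟨fun i => (b i).cast, funext fun i => (ZMod.intCast_zmod_cast _).symm⟩
  have hsum := SuperellipticCurve.sum_divClass hO hP
  have hexact : Function.Exact Δ s := by
    intro b
    constructor
    · intro hb
      obtain ⟨a, rfl⟩ := hlift b
      obtain ⟨j, hj⟩ := SuperellipticCurve.exists_forall_eq_of_sum_zsmul_eq_zero hζ hO hP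
        (by rw [← hs, hb]; rfl)
      exact ⟨j, funext fun i => by rw [hΔ, hj]⟩
    · rintro ⟨z, rfl⟩
      have h1 : s (fun _ => 1) = 0 := by
        refine Subtype.ext ?_
        have := hs fun _ => 1
        simp only [Int.cast_one, one_smul] at this
        exact this.trans hsum
      rw [LinearMap.toSpanSingleton_apply, map_smul, h1, smul_zero]
  have hsurj : Function.Surjective s := by
    intro z
    obtain ⟨a, ha⟩ := SuperellipticCurve.exists_eq_sum_zsmul_divClass hζ hO hP z.2
    exact ⟨_, Subtype.ext ((hs a).trans ha.symm)⟩
  have hr : (LinearMap.proj i₀ : (Fin E.d → ZMod E.n) →ₗ[ZMod E.n] ZMod E.n) ∘ₗ Δ =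
      LinearMap.id := LinearMap.ext fun z => hΔ z i₀
  obtain ⟨t, ht₁, ht₂⟩ := hexact.exists_splitting hsurj hr
  refine ⟨inst, Δ, s, funext fun i => hΔ 1 i, hs,
    fun z w h => by simpa only [hΔ] using congrFun h i₀, hexact, hsurj, ⟨_, t, hr, ht₁, ht₂⟩, ?_,
    SuperellipticCurve.closure_range_divClass hζ hO hP, hsum⟩
  rw [hexact.linearMap_ker_eq, LinearMap.range_toSpanSingleton]
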